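/- Let $d\ge 1$, $L,\Delta\in\mathbb R$ and $a>0$. Let $F:\mathbb R^d\to\mathbb R$ be differentiable, bounded from below, with $\|\nabla F(x)-\nabla F(y)\|\le L\|x-y\|$ for all $x,y$, and let $x^1\in\mathbb R^d$ be a deterministic point with $F(x^1)-\inf F\le\Delta$. A stochastic first-order oracle, queried at $x$, returns $\nabla f(x;\xi)$ for a random sample $\xi$; its noise is $\nabla f(x;\xi)-\nabla F(x)$. The step-sizes are $\alpha_t=a/\sqrt{t+1}$, $t\ge1$. A map $\Psi:\mathbb R^d\to\mathbb R^d$ satisfies condition (N) if it has one of the following two forms. (i) Component-wise, $\Psi(x)=[\psi(x_1),\dots,\psi(x_d)]^\top$, where $\psi$ is non-decreasing, odd, bounded, continuous except at finitely many points, piece-wise differentiable with bounded derivative, and either discontinuous at $0$ or strictly increasing on some interval $(-c,c)$, $c>0$. (ii) Joint, $\Psi(x)=x\,\varphi(\|x\|)$, where $\varphi$ is continuous except at finitely many points, $\varphi>0$ and non-increasing on $(0,\infty)$, $r\mapsto r\varphi(r)$ is non-decreasing on $(0,\infty)$, and $\Psi$ is bounded. It satisfies condition (N') if it satisfies (N)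 and, whenever it is of the component-wise form $[\psi(x_1),\dots,\psi(x_d)]^\top$, $\psi$ is twice continuously differentiable with bounded first and second derivatives. (A) N-SGD. Let $x^{t+1}=x^t-\alpha_t\Psi(\nabla f(x^t;\xi^t))$, $t\ge1$, with $\Psi$ satisfying (N'). Assume that for every $t$ the noise $z^t=\nabla f(x^t;\xi^t)-\nabla F(x^t)$ has, conditionally on $x^1,\dots,x^t$, the probability density $P_{x^t}$, where $(P_x)_{x\in\mathbb R^d}$ is a family of densities with $P_x(-z)=P_x(z)$ for all $x,z$, and, for some $E_0>0$, $\inf_{x}P_x(z)>0$ for all $\|z\|\le E_0$. No moment of the noise is assumed to exist. (B) N-SGE. Let $y\in\mathbb R^d$ be a reference point at which $\nabla F(y)$ is known, and let $x^{t+1}=x^t-\alpha_t\Psi(\nabla f(x^t;\xi_1^t)-\nabla f(y;\xi_2^t)+\nabla F(y))$, $t\ge1$, with $\Psi$ satisfying (N). Assume that the noise vectors $z_1^t=\nabla f(x^t;\xi^t_1)-\nabla F(x^t)$ and $z_2^t=\nabla f(y;\xi^t_2)-\nabla F(y)$, $t\ge1$, are all independent with one common probability density $P$ such that, for some $E_0>0$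 and all $\|x\|\le E_0$, the set $\{u: P(u)>0,\ P(u-x)>0\}$ has positive Lebesgue measure. In each of the cases (A) and (B) there are constants $M,K>0$ that depend only on $d$, $\Psi$, the noise density (the family $(P_x)$ in (A), $P$ in (B)), $L$, $\Delta$ and $a$, such that the following hold. 1. For every integer $t\ge2$ and every $\delta\in(0,1)$, with probability at least $1-\delta$, $$\min_{1\le k\le t}\|\nabla F(x^k)\|^2\le M\,\frac{\log(t/\delta)}{\sqrt t}.$$ 2. For every $\varepsilon\in(0,1]$, $\delta\in(0,1)$ and every integer $n\ge K\varepsilon^{-4}\big(1+\log\frac1{\varepsilon\delta}\big)^2$, with probability at least $1-\delta$ at least one of the iterates $x^k$ obtained with at most $n$ oracle calls satisfies $\|\nabla F(x^k)\|\le\varepsilon$. (N-SGD makes one and N-SGE two oracle calls per iteration.) That is, the oracle complexity is $\mathcal O(\varepsilon^{-4})$ up to logarithmic factors. In particular, this covers all step-size parameters $a\le\min\{1,\frac{\beta_2}{8C^2},\frac{\beta_1}{16C^2(LC+\frac12\|\nabla F(x^1)\|)}\}$, where $C$ is a bound on $\|\Psi\|$ and $\beta_1,\beta_2>0$ are constants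 depending on $\Psi$ and the noise. -/

import Mathlib

open MeasureTheory ProbabilityTheory

universe u v

noncomputable section

/-- The space `ℝ^d` with the Euclidean norm. -/
abbrev Vec (d : ℕ) : Type := EuclideanSpace ℝ (Fin d)

/-! ### The cost -/

/-- `F` is differentiable, bounded from below, and has an `L`-Lipschitz gradient. -/
structure IsSmoothCost {d : ℕ} (F : Vec d → ℝ) (L : ℝ) : Prop where
  differentiable : Differentiable ℝ F
  bddBelow : BddBelow (Set.range F)
  lipschitz_gradient : ∀ x y, ‖gradient F x - gradient F y‖ ≤ L * ‖x - y‖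

/-! ### The nonlinearity -/

/-- `Ψ(x) = [ψ(x_1), …, ψ(x_d)]`. -/
def IsComponentwise {d : ℕ} (Ψ : Vec d → Vec d) (ψ : ℝ → ℝ) : Prop :=
  ∀ x i, Ψ x i = ψ (x i)

/-- `Ψ(x) = x φ(‖x‖)`. -/
def IsJoint {d : ℕ} (Ψ : Vec d → Vec d) (φ : ℝ → ℝ) : Prop :=
  ∀ x, Ψ x = φ ‖x‖ • x

/-- The conditions on the scalar map of a component-wise nonlinearity. Piece-wise
differentiable means differentiable off a set with finitely many points in each bounded interval. -/
structure ComponentCond (ψ : ℝ → ℝ) : Prop where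
  continuous_off_finite : ∃ S : Set ℝ, S.Finite ∧ ∀ x ∉ S, ContinuousAt ψ x
  piecewise_differentiable : ∃ c₁ > 0, ∃ S : Set ℝ, (∀ r : ℝ, (S ∩ Set.Icc (-r) r).Finite) ∧
    ∀ x ∉ S, DifferentiableAt ℝ ψ x ∧ |deriv ψ x| ≤ c₁
  monotone : Monotone ψ
  odd : ∀ x, ψ (-x) = -ψ x
  nondegenerate : ¬ ContinuousAt ψ 0 ∨ ∃ c₂ > 0, StrictMonoOn ψ (Set.Ioo (-c₂) c₂)
  bounded : ∃ C₁ > 0, ∀ x, |ψ x| ≤ C₁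

/-- The conditions on the scalar map of a joint nonlinearity on `ℝ^d`. -/
structure JointCond (d : ℕ) (φ : ℝ → ℝ) : Prop where
  continuous_off_finite : ∃ S : Set ℝ, S.Finite ∧ ∀ x ∉ S, ContinuousAt φ x
  mul_monotone : MonotoneOn (fun a => a * φ a) (Set.Ioi 0)
  antitone : AntitoneOn φ (Set.Ioi 0)
  pos : ∀ a, 0 < a → 0 < φ a
  bounded : ∃ C₂ > 0, ∀ x : Vec d, ‖φ ‖x‖ • x‖ ≤ C₂

/-- The general assumption on the nonlinearity. -/
def Nonlinearity {d : ℕ} (Ψ : Vec d → Vec d) : Prop :=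
  (∃ ψ, IsComponentwise Ψ ψ ∧ ComponentCond ψ) ∨ (∃ φ, IsJoint Ψ φ ∧ JointCond d φ)

/-- The assumption on the nonlinearity for state-dependent noise: the general one and,
if `Ψ` is component-wise, its scalar map is `C²` with bounded first and second derivatives. -/
structure SmoothNonlinearity {d : ℕ} (Ψ : Vec d → Vec d) : Prop where
  general : Nonlinearity Ψ
  smooth : ∀ ψ, IsComponentwise Ψ ψ → ContDiff ℝ 2 ψ ∧
    (∃ K₁ > 0, ∀ x, |deriv ψ x| ≤ K₁) ∧ (∃ K₂ > 0, ∀ x, |deriv (deriv ψ) x| ≤ K₂)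

/-! ### The methods -/

/-- A gradient estimator making `q` oracle queries per iteration: the `j`-th query point as a
function of the current model, and how the `q` answers are combined. -/
structure GradEstimator (d q : ℕ) where
  point : Fin q → Vec d → Vec d
  combine : (Fin q → Vec d) → Vec d

/-- `g = ∇f(x; ξ)`. -/
def sgd (d : ℕ) : GradEstimator d 1 where
  point := fun _ x => x
  combine := fun g => g 0

/-- `g = ∇f(x; ξ₁) - ∇f(y; ξ₂) + ∇F(y)`. -/
def sge {d : ℕ} (F : Vec d → ℝ) (y : Vec d) : GradEstimator d 2 where
  point := ![fun x => x, fun _ => y]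
  combine := fun g => g 0 - g 1 + gradient F y

/-- The answer `∇f(x; s)` of the stochastic first-order oracle to the query `x`, on sample `s`. -/
def oracle {d : ℕ} {Ξ : Type v} (f : Vec d → Ξ → ℝ) (x : Vec d) (s : Ξ) : Vec d :=
  gradient (fun y => f y s) x

/-- The loss is differentiable in the model and its gradient is jointly measurable. -/
structure IsLoss {d : ℕ} {Ξ : Type v} [MeasurableSpace Ξ] (f : Vec d → Ξ → ℝ) : Prop where
  differentiable : ∀ s, Differentiable ℝ (fun x => f x s)
  measurable : Measurable (fun p : Vec d × Ξ => oracle f p.1 p.2)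

/-- The step-size `α_t = a / (t+1)^η`. -/
def stepSize (a η : ℝ) (t : ℕ) : ℝ := a / ((t : ℝ) + 1) ^ η

/-- The models `x^1, x^2, …` (index `0` is not used) are generated from `x^1 = x₁` by
`x^{t+1} = x^t - α_t Ψ(g^t)`, where `g^t` is the estimator at `x^t` with samples `ξ^t_j`. -/
structure IsRun {d q : ℕ} {Ω : Type u} {Ξ : Type v} (est : GradEstimator d q)
    (Ψ : Vec d → Vec d) (f : Vec d → Ξ → ℝ) (α : ℕ → ℝ) (x₁ : Vec d)
    (ξ : ℕ → Fin q → Ω → Ξ) (x : ℕ → Ω → Vec d) : Prop where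
  init : ∀ ω, x 1 ω = x₁
  step : ∀ t, 1 ≤ t → ∀ ω, x (t + 1) ω =
    x t ω - α t • Ψ (est.combine fun j => oracle f (est.point j (x t ω)) (ξ t j ω))

/-- The noise of the answer to the `j`-th query in iteration `t`. -/
def noise {d q : ℕ} {Ω : Type u} {Ξ : Type v} (est : GradEstimator d q)
    (F : Vec d → ℝ) (f : Vec d → Ξ → ℝ) (ξ : ℕ → Fin q → Ω → Ξ) (x : ℕ → Ω → Vec d)
    (t : ℕ) (j : Fin q) (ω : Ω) : Vec d :=
  oracle f (est.point j (x t ω)) (ξ t j ω) - gradient F (est.point j (x t ω))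

/-! ### The noise -/

/-- `p` is a probability density function on `ℝ^d`. -/
structure IsPDF {d : ℕ} (p : Vec d → ℝ) : Prop where
  measurable : Measurable p
  nonneg : ∀ z, 0 ≤ p z
  lintegral_eq_one : ∫⁻ z, ENNReal.ofReal (p z) = 1

/-- `(P_x)` is a measurable family of symmetric densities, uniformly positive around the origin. -/
structure IsSymmetricNoise {d : ℕ} (P : Vec d → Vec d → ℝ) : Prop where
  measurable : Measurable (Function.uncurry P)
  pdf : ∀ x, IsPDF (P x)
  symmetric : ∀ x z, P x (-z) = P x z
  positive : ∃ E₀ > 0, ∀ z, ‖z‖ ≤ E₀ → 0 < ⨅ x, P x z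

/-- The σ-algebra generated by `x^1, …, x^t`. -/
@[reducible] def past {d : ℕ} {Ω : Type u} (x : ℕ → Ω → Vec d) (t : ℕ) : MeasurableSpace Ω :=
  ⨆ k ∈ Finset.Icc 1 t, MeasurableSpace.comap (x k) inferInstance

/-- Given the past `x^1, …, x^t`, the noise `z^t` has the density `P_{x^t}`. -/
def HasStateDensity {d : ℕ} {Ω : Type u} [MeasurableSpace Ω] (μ : Measure Ω)
    (x z : ℕ → Ω → Vec d) (P : Vec d → Vec d → ℝ) : Prop :=
  ∀ t, 1 ≤ t → ∀ B : Set (Vec d), MeasurableSet B →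
    μ[(z t ⁻¹' B).indicator (fun _ => (1 : ℝ)) | past x t] =ᵐ[μ]
      fun ω => ∫ u in B, P (x t ω) u

/-- `P` is a density such that, for small `x`, `{y : P(y) > 0, P(y - x) > 0}` has positive
Lebesgue measure. -/
structure IsOverlapNoise {d : ℕ} (P : Vec d → ℝ) : Prop where
  pdf : IsPDF P
  overlap : ∃ E₀ > 0, ∀ x, ‖x‖ ≤ E₀ → 0 < volume {y : Vec d | 0 < P y ∧ 0 < P (y - x)}

/-- The vectors `z^t_j`, `t ≥ 1`, `j < q`, are independent and all have the density `P`. -/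
structure IsIIDNoise {d q : ℕ} {Ω : Type u} [MeasurableSpace Ω] (μ : Measure Ω)
    (z : ℕ → Fin q → Ω → Vec d) (P : Vec d → ℝ) : Prop where
  indep : iIndepFun (fun p : ℕ × Fin q => z (p.1 + 1) p.2) μ
  law : ∀ t, 1 ≤ t → ∀ j,
    μ.map (z t j) = (volume : Measure (Vec d)).withDensity (fun u => ENNReal.ofReal (P u))

/-! ### The guarantees -/

/-- `min_{1 ≤ k ≤ t} ‖∇F(x^k)‖²`. -/
def minSqGrad {d : ℕ} (F : Vec d → ℝ) (x : ℕ → Vec d) (t : ℕ) : ℝ :=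
  ⨅ k : Finset.Icc 1 t, ‖gradient F (x k)‖ ^ 2

/-- For all `t ≥ 2` and `δ ∈ (0,1)`, with probability at least `1 - δ`,
`min_{k ≤ t} ‖∇F(x^k)‖² ≤ M log(t/δ) / √t`. -/
def HasRate {d : ℕ} {Ω : Type u} [MeasurableSpace Ω] (μ : Measure Ω) (F : Vec d → ℝ)
    (x : ℕ → Ω → Vec d) (M : ℝ) : Prop :=
  ∀ t : ℕ, 2 ≤ t → ∀ δ : ℝ, 0 < δ → δ < 1 →
    ENNReal.ofReal (1 - δ) ≤
      μ {ω | minSqGrad F (fun k => x k ω) t ≤ M * (Real.log (t / δ) / Real.sqrt t)}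

/-- The number of oracle calls made in iterations `1, …, k-1`, that is, until `x^k` is known,
with `q` calls per iteration. -/
def oracleCalls (q k : ℕ) : ℕ := ∑ _s ∈ Finset.Ico 1 k, q

/-- For all `ε ∈ (0,1]` and `δ ∈ (0,1)`, and every budget `n` of oracle calls of at least
`K ε⁻⁴ (1 + log(1/(εδ)))²`, with probability at least `1 - δ` one of the models obtained within
`n` oracle calls is an `ε`-stationary point. -/
def HasComplexity {d : ℕ} {Ω : Type u} [MeasurableSpace Ω] (q : ℕ) (μ : Measure Ω)
    (F : Vec d → ℝ) (x : ℕ → Ω → Vec d) (K : ℝ) : Prop :=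
  ∀ ε : ℝ, 0 < ε → ε ≤ 1 → ∀ δ : ℝ, 0 < δ → δ < 1 → ∀ n : ℕ,
    K * (1 / ε ^ 4) * (1 + Real.log (1 / (ε * δ))) ^ 2 ≤ n →
    ENNReal.ofReal (1 - δ) ≤
      μ {ω | ∃ k, 1 ≤ k ∧ oracleCalls q k ≤ n ∧ ‖gradient F (x k ω)‖ ≤ ε}

end

/-! The noise has no moments, so everything rests on the boundedness of `Ψ` and on one drift
inequality: under every conditional noise law, the mean of `⟨Ψ(v + z), v⟩` is at least `β *
minNormSq v`, with `β` independent of the state. The minimum of `‖v‖` and `‖v‖²` is natural: a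
bounded `Ψ` gives at most linear growth for large `v`, and a quadratic gain is what can be expected
for small `v`.

The drift inequality comes from symmetry. A symmetric law lets `z` be averaged with `-z`, and the
resulting `symDrift` is nonnegative for every `z`, so it suffices to bound it below on noise values
of uniformly positive probability. For joint maps in dimension at least two these are noise vectors
nearly orthogonal to `v`; for component-wise maps only the largest coordinate of `v` is used
(`IsJoint.exists_drift`, `IsComponentwise.exists_drift_of_contDiff`,
`IsComponentwise.exists_drift_of_density`). For N-SGE the effective noise is a difference of two
independent vectors with a common density; it is symmetric, and a Steinhaus argument bounds its
density below near the origin.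

Given the drift, `exp (l * driftGap)` has expectation at most one for a small constant `l`
(`lintegral_exp_driftGap_le_one`), and Markov's inequality bounds the gap by `log (1/δ) / l` with
probability at least `1 - δ`. A constant `l` works for every `a > 0` because bounded updates let
gradients grow only like `√t`, which the step-sizes cancel. The descent lemma then bounds `∑ α_k *
minNormSq (∇F(x^k))` by a multiple of `log (t/δ)`, while `∑ α_k` is of order `√t`; this is the rate,
and inverting it gives the complexity. -/

/-! ### Smooth costs -/

/-- The gradient and the Fréchet derivative determine the same difference norms. -/
lemma norm_fderiv_sub_eq_norm_gradient_sub {d : ℕ} (F : Vec d → ℝ) (x y : Vec d) :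
    ‖fderiv ℝ F x - fderiv ℝ F y‖ = ‖gradient F x - gradient F y‖ := by
  rw [← toDual_gradient, ← toDual_gradient, ← map_sub, LinearIsometryEquiv.norm_map]

namespace IsSmoothCost

variable {d : ℕ} {F : Vec d → ℝ} {L L' : ℝ}

lemma mono (hF : IsSmoothCost F L) (h : L ≤ L') : IsSmoothCost F L' :=
  ⟨hF.differentiable, hF.bddBelow, fun x y => (hF.lipschitz_gradient x y).trans
    (mul_le_mul_of_nonneg_right h (norm_nonneg _))⟩

lemma continuous_gradient (hF : IsSmoothCost F L) : Continuous (gradient F) :=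
  (LipschitzWith.of_dist_le' (K := L) fun x y => by
    simpa [dist_eq_norm] using hF.lipschitz_gradient x y).continuous

/-- The descent lemma, with a crude constant. -/
lemma le_add_inner (hF : IsSmoothCost F L) (hL : 0 ≤ L) (x y : Vec d) :
    F y ≤ F x + inner ℝ (gradient F x) (y - x) + L * ‖y - x‖ ^ 2 := by
  have h := Convex.norm_image_sub_le_of_norm_fderiv_le' (𝕜 := ℝ) (f := F) (s := segment ℝ x y)
    (x := x) (y := y) (φ := fderiv ℝ F x) (C := L * ‖y - x‖)
    (fun z _ => hF.differentiable z) (fun z hz => by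
      rw [norm_fderiv_sub_eq_norm_gradient_sub]
      refine (hF.lipschitz_gradient z x).trans (mul_le_mul_of_nonneg_left ?_ hL)
      simpa [norm_sub_rev] using norm_sub_le_of_mem_segment hz) (convex_segment x y)
    (left_mem_segment ℝ x y) (right_mem_segment ℝ x y)
  rw [← toDual_gradient, InnerProductSpace.toDual_apply_apply] at h
  have := (le_abs_self _).trans h
  nlinarith

/-- The gradient is controlled by the optimality gap. -/
lemma sq_norm_gradient_le (hF : IsSmoothCost F L) (hL : 0 < L) (x : Vec d) :
    ‖gradient F x‖ ^ 2 ≤ 4 * L * (F x - ⨅ y, F y) := by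
  set g := gradient F x
  -- The step `1 / (2L)` minimizes the quadratic upper bound along `-g`.
  have h := hF.le_add_inner hL.le x (x - (1 / (2 * L)) • g)
  have h2 := ciInf_le hF.bddBelow (x - (1 / (2 * L)) • g)
  have e : x - (1 / (2 * L)) • g - x = -((1 / (2 * L)) • g) := by abel
  rw [e, inner_neg_right, inner_smul_right, real_inner_self_eq_norm_sq, norm_neg, norm_smul,
    Real.norm_of_nonneg (by positivity)] at h
  have h3 : 1 / (2 * L) * ‖g‖ ^ 2 - L * (1 / (2 * L) * ‖g‖) ^ 2 = ‖g‖ ^ 2 / (4 * L) := by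
    field_simp; ring
  have h4 : ‖g‖ ^ 2 / (4 * L) ≤ F x - ⨅ y, F y := by linarith
  rw [div_le_iff₀ (by positivity)] at h4
  linarith

end IsSmoothCost

/-! ### Step-sizes -/

lemma stepSize_half (a : ℝ) (t : ℕ) : stepSize a (1 / 2) t = a / √((t : ℝ) + 1) := by
  rw [stepSize, Real.sqrt_eq_rpow]

lemma sum_inv_sqrt_succ_le (t : ℕ) :
    ∑ k ∈ Finset.Ico 1 t, 1 / √((k : ℝ) + 1) ≤ 2 * √(t : ℝ) := by
  induction t with
  | zero => simp
  | succ t ih =>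
    rcases Nat.eq_zero_or_pos t with rfl | ht
    · simp
    rw [Finset.sum_Ico_succ_top ht]
    push_cast
    have h1 : 0 < √((t : ℝ) + 1) := by positivity
    have h2 := Real.sq_sqrt (show (0 : ℝ) ≤ (t : ℝ) + 1 by positivity)
    have h3 := Real.sq_sqrt (show (0 : ℝ) ≤ (t : ℝ) by positivity)
    have h4 : √(t : ℝ) ≤ √((t : ℝ) + 1) := Real.sqrt_le_sqrt (by linarith)
    have h5 : 1 / √((t : ℝ) + 1) ≤ 2 * √((t : ℝ) + 1) - 2 * √(t : ℝ) := by
      rw [div_le_iff₀ h1]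
      nlinarith [sq_nonneg (√((t : ℝ) + 1) - √(t : ℝ))]
    linarith

/-- Each term is at most an increment of the logarithm, by `1 - 1/u ≤ log u` at `u = (t + 2) / (t +
1)`. -/
lemma sum_inv_succ_le_log (t : ℕ) :
    ∑ k ∈ Finset.Ico 1 (t + 1), 1 / ((k : ℝ) + 1) ≤ Real.log ((t : ℝ) + 1) := by
  induction t with
  | zero => simp
  | succ t ih =>
    rw [Finset.sum_Ico_succ_top (by omega)]
    have h := Real.one_sub_inv_le_log_of_pos
      (show (0 : ℝ) < ((t : ℝ) + 1 + 1) / (t + 1) by positivity)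
    rw [Real.log_div (by positivity) (by positivity)] at h
    have e : 1 - (((t : ℝ) + 1 + 1) / (t + 1))⁻¹ = 1 / ((t : ℝ) + 1 + 1) := by
      field_simp; ring
    rw [e] at h
    push_cast
    linarith

lemma sqrt_le_sum_inv_sqrt_succ {t : ℕ} (ht : 1 ≤ t) :
    √(t : ℝ) / 2 ≤ ∑ k ∈ Finset.Ico 1 (t + 1), 1 / √((k : ℝ) + 1) := by
  have h1 : ∀ k ∈ Finset.Ico 1 (t + 1), 1 / √((t : ℝ) + 1) ≤ 1 / √((k : ℝ) + 1) := by
    intro k hk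
    have : (k : ℝ) ≤ t := by exact_mod_cast Nat.lt_succ_iff.mp (Finset.mem_Ico.mp hk).2
    gcongr
  have h2 := Finset.card_nsmul_le_sum _ _ _ h1
  simp only [Nat.card_Ico, Nat.add_sub_cancel, nsmul_eq_mul] at h2
  refine le_trans ?_ h2
  have ht' : (1 : ℝ) ≤ t := by exact_mod_cast ht
  have h3 : √((t : ℝ) + 1) ≤ 2 * √(t : ℝ) := by
    rw [Real.sqrt_le_left (by positivity), mul_pow, Real.sq_sqrt (by positivity)]
    linarith
  have h4 := Real.mul_self_sqrt (show (0 : ℝ) ≤ (t : ℝ) by positivity)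
  rw [mul_one_div, div_le_div_iff₀ (by norm_num) (by positivity)]
  nlinarith [Real.sqrt_nonneg (t : ℝ)]

/-! ### From the rate to the oracle complexity -/

/-- With `S` the square root of the lower bound for `s`, the tangent bound for the logarithm at `S`
gives `log √s ≤ √s / S - 1 + log S`, so `log (s/δ) / √s` is at most a multiple of `w * l / S`. One
factor `w` of `S` then remains to absorb `M`. -/
lemma log_div_div_sqrt_le {M ε δ s : ℝ} (hM : 0 < M) (hε : 0 < ε) (hε1 : ε ≤ 1) (hδ : 0 < δ)
    (hδ1 : δ < 1)
    (hs : (13 * M + 1) ^ 4 * (1 / ε ^ 4) * (1 + Real.log (1 / (ε * δ))) ^ 2 ≤ s) :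
    M * (Real.log (s / δ) / √s) ≤ ε ^ 2 := by
  set w := 13 * M + 1 with hw
  set l := 1 + Real.log (1 / (ε * δ)) with hl
  have hw1 : 1 ≤ w := by linarith
  have hlε : 0 ≤ Real.log (1 / ε) := Real.log_nonneg (by rw [le_div_iff₀ hε]; linarith)
  have hlδ : 0 ≤ Real.log (1 / δ) := Real.log_nonneg (by rw [le_div_iff₀ hδ]; linarith)
  have hl' : l = 1 + Real.log (1 / ε) + Real.log (1 / δ) := by
    rw [hl, show 1 / (ε * δ) = 1 / ε * (1 / δ) by field_simp, Real.log_mul (by positivity)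
      (by positivity)]; ring
  have hl1 : 1 ≤ l := by linarith
  set S := w ^ 2 * (1 / ε ^ 2) * l with hS
  have hSpos : 0 < S := by positivity
  have hε2 : 1 ≤ 1 / ε ^ 2 := by
    rw [le_div_iff₀ (by positivity)]; nlinarith
  have hS1 : 1 ≤ S := by
    have : 1 ≤ w ^ 2 := by nlinarith
    exact one_le_mul_of_one_le_of_one_le (one_le_mul_of_one_le_of_one_le this hε2) hl1
  have hSs : S ≤ √s := by
    apply Real.le_sqrt_of_sq_le
    refine le_of_eq_of_le ?_ hs
    rw [hS]; field_simp
  have hs0 : 0 < √s := hSpos.trans_le hSs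
  have hspos : 0 < s := Real.sqrt_pos.mp hs0
  have h1 : Real.log s = 2 * Real.log √s := by
    rw [Real.log_sqrt hspos.le]; ring
  have h2 : Real.log √s ≤ √s / S - 1 + Real.log S := by
    have := Real.log_le_sub_one_of_pos (show 0 < √s / S by positivity)
    rw [Real.log_div hs0.ne' hSpos.ne'] at this
    linarith
  have hlogw : Real.log w ≤ w := (Real.log_le_sub_one_of_pos (by linarith)).trans (by linarith)
  have h3 : Real.log S ≤ 2 * w + 3 * l := by
    have e : Real.log S = 2 * Real.log w + 2 * Real.log (1 / ε) + Real.log l := by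
      rw [hS, Real.log_mul (by positivity) (by positivity), Real.log_mul (by positivity)
        (by positivity), Real.log_pow, ← one_div_pow, Real.log_pow]; push_cast; ring
    have := Real.log_le_sub_one_of_pos (show 0 < l by positivity)
    linarith
  have hlogS : 0 ≤ Real.log S := Real.log_nonneg hS1
  have h4 : Real.log (s / δ) / √s ≤ (13 * w * l) / S := by
    rw [div_le_div_iff₀ hs0 hSpos, div_eq_mul_one_div s, Real.log_mul hspos.ne' (by positivity),
      h1]
    have e : √s / S * S = √s := div_mul_cancel₀ _ hSpos.ne'
    have h5 : 2 * Real.log √s * S ≤ 2 * √s + 2 * Real.log S * √s := by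
      have : Real.log √s * S ≤ (√s / S - 1 + Real.log S) * S :=
        mul_le_mul_of_nonneg_right h2 hSpos.le
      have : Real.log S * S ≤ Real.log S * √s := mul_le_mul_of_nonneg_left hSs hlogS
      nlinarith
    have h6 : Real.log (1 / δ) * S ≤ l * √s :=
      mul_le_mul (by linarith) hSs hSpos.le (by linarith)
    -- Here `log S ≤ 2w + 3l`, and `13 = 2 + 4 + 7` since `w, l ≥ 1`.
    have h7 : 2 + 2 * Real.log S + l ≤ 13 * w * l := by nlinarith
    have := mul_le_mul_of_nonneg_right h7 hs0.le
    nlinarith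
  have h5 : 13 * w * l / S = 13 * ε ^ 2 / w := by
    rw [hS]; field_simp
  calc M * (Real.log (s / δ) / √s) ≤ M * (13 * ε ^ 2 / w) := by
        rw [← h5]; exact mul_le_mul_of_nonneg_left h4 hM.le
    _ = ε ^ 2 * (13 * M / w) := by ring
    _ ≤ ε ^ 2 * 1 := by
        refine mul_le_mul_of_nonneg_left ?_ (by positivity)
        rw [div_le_one (by linarith)]; linarith
    _ = ε ^ 2 := mul_one _

lemma exists_sq_le_of_minSqGrad_le {d : ℕ} {F : Vec d → ℝ} {x : ℕ → Vec d} {t : ℕ} {r : ℝ}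
    (ht : 1 ≤ t) (h : minSqGrad F x t ≤ r) : ∃ k, 1 ≤ k ∧ k ≤ t ∧ ‖gradient F (x k)‖ ^ 2 ≤ r := by
  have : Nonempty (Finset.Icc 1 t) := ⟨⟨1, by simp [ht]⟩⟩
  obtain ⟨k, hk⟩ := exists_eq_ciInf_of_finite
    (f := fun k : Finset.Icc 1 t => ‖gradient F (x k)‖ ^ 2)
  have hk' := Finset.mem_Icc.mp k.2
  exact ⟨k, hk'.1, hk'.2, hk.le.trans h⟩

lemma minSqGrad_le {d : ℕ} {F : Vec d → ℝ} {x : ℕ → Vec d} {t k : ℕ} (hk : 1 ≤ k) (hkt : k ≤ t) :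
    minSqGrad F x t ≤ ‖gradient F (x k)‖ ^ 2 :=
  ciInf_le (f := fun k : Finset.Icc 1 t => ‖gradient F (x k)‖ ^ 2)
    ⟨0, by rintro _ ⟨k, rfl⟩; positivity⟩ ⟨k, by simp [hk, hkt]⟩

/-- A rate in high probability gives an oracle complexity. -/
lemma HasRate.hasComplexity {d q : ℕ} (hq : 1 ≤ q) {Ω : Type*} [MeasurableSpace Ω]
    {μ : Measure Ω} {F : Vec d → ℝ} {x : ℕ → Ω → Vec d} {M : ℝ} (hM : 0 < M)
    (h : HasRate μ F x M) : HasComplexity q μ F x (q * (13 * M + 1) ^ 4) := by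
  intro ε hε hε1 δ hδ hδ1 n hn
  have hq' : (0 : ℝ) < q := by exact_mod_cast hq
  set X := (13 * M + 1) ^ 4 * (1 / ε ^ 4) * (1 + Real.log (1 / (ε * δ))) ^ 2 with hX
  have hXn : X ≤ (n : ℝ) / q := by
    rw [le_div_iff₀ hq']; refine le_of_eq_of_le ?_ hn; rw [hX]; ring
  have hX1 : 1 ≤ X := by
    have hl : 0 ≤ Real.log (1 / (ε * δ)) := by
      refine Real.log_nonneg ?_
      rw [le_div_iff₀ (by positivity)]; nlinarith
    have h1 : 1 ≤ 1 / ε ^ 4 := by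
      rw [le_div_iff₀ (by positivity), one_mul]; exact pow_le_one₀ hε.le hε1
    have h2 : 1 ≤ (13 * M + 1) ^ 4 := one_le_pow₀ (by linarith)
    exact one_le_mul_of_one_le_of_one_le (one_le_mul_of_one_le_of_one_le h2 h1)
      (one_le_pow₀ (by linarith))
  have hnq : (n : ℝ) / q < (n / q : ℕ) + 1 := by
    rw [div_lt_iff₀ hq']
    exact_mod_cast Nat.lt_mul_of_div_lt (Nat.lt_succ_self _) hq
  have hd1 : 1 ≤ n / q := by
    have : (0 : ℝ) < (n / q : ℕ) := by linarith
    exact_mod_cast this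
  -- The iterate `x^k` costs `(k - 1) * q` calls, so `n` calls reach the index `n / q + 1`. The
  -- extra one makes up for the rounding in `n / q`, and `X ≥ 1` makes this index at least two.
  refine (h (n / q + 1) (by omega) δ hδ hδ1).trans (measure_mono fun ω hω => ?_)
  obtain ⟨k, hk1, hk2, hk3⟩ := exists_sq_le_of_minSqGrad_le (by omega) hω
  refine ⟨k, hk1, ?_, ?_⟩
  · simp only [oracleCalls, Finset.sum_const, Nat.card_Ico, smul_eq_mul]
    calc (k - 1) * q ≤ n / q * q := Nat.mul_le_mul_right _ (by omega)
      _ ≤ n := Nat.div_mul_le_self _ _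
  · have h4 := log_div_div_sqrt_le hM hε hε1 hδ hδ1 (s := ((n / q + 1 : ℕ) : ℝ))
      (by push_cast; linarith)
    exact (sq_le_sq₀ (norm_nonneg _) hε.le).mp (hk3.trans h4)

/-! ### Disintegration along a state kernel -/

/-- If `η` is the conditional law of `z` given `X`, it computes expectations of functions of
`(X, z)`. -/
lemma lintegral_eq_lintegral_lintegral_of_forall_rect {Ω Ω' E : Type*} [MeasurableSpace Ω]
    [MeasurableSpace Ω'] [MeasurableSpace E] {μ : Measure Ω} [IsFiniteMeasure μ] {X : Ω → Ω'}
    {z : Ω → E} {η : Kernel Ω' E} [IsMarkovKernel η] (hX : Measurable X) (hz : Measurable z)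
    (h : ∀ S B, MeasurableSet S → MeasurableSet B →
      μ (X ⁻¹' S ∩ z ⁻¹' B) = ∫⁻ ω in X ⁻¹' S, η (X ω) B ∂μ)
    {g : Ω' × E → ENNReal} (hg : Measurable g) :
    ∫⁻ ω, g (X ω, z ω) ∂μ = ∫⁻ ω, ∫⁻ u, g (X ω, u) ∂η (X ω) ∂μ := by
  have key : μ.map (fun ω => (X ω, z ω)) = (μ.map X).compProd η := by
    refine Measure.ext_prod fun {S B} hS hB => ?_
    rw [Measure.map_apply (hX.prodMk hz) (hS.prod hB), Measure.compProd_apply_prod hS hB,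
      setLIntegral_map hS (η.measurable_coe hB) hX, ← h S B hS hB]
    rfl
  rw [← lintegral_map hg (hX.prodMk hz), key, Measure.lintegral_compProd hg,
    lintegral_map (hg.lintegral_kernel_prod_right') hX]

/-- Given the past `x 1, …, x t`, the law of `z t` is `κ (x t)`. -/
def HasStateKernel {d : ℕ} {Ω : Type*} [MeasurableSpace Ω] (μ : Measure Ω)
    (x z : ℕ → Ω → Vec d) (κ : Kernel (Vec d) (Vec d)) : Prop :=
  ∀ t, 1 ≤ t → ∀ S B, MeasurableSet[past x t] S → MeasurableSet B →
    μ (S ∩ z t ⁻¹' B) = ∫⁻ ω in S, κ (x t ω) B ∂μ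

/-- The index `k` moved into `{1, …, t}`. -/
def clampIndex (t k : ℕ) : ℕ := max 1 (min k t)

lemma clampIndex_of_mem {t k : ℕ} (h1 : 1 ≤ k) (h2 : k ≤ t) : clampIndex t k = k := by
  simp [clampIndex, h1, h2]

lemma measurable_past {d : ℕ} {Ω : Type*} (x : ℕ → Ω → Vec d) {t k : ℕ} (h1 : 1 ≤ k)
    (h2 : k ≤ t) : Measurable[past x t] (x k) :=
  (comap_measurable (x k)).mono (le_iSup₂_of_le k (Finset.mem_Icc.mpr ⟨h1, h2⟩) le_rfl) le_rfl

lemma past_le {d : ℕ} {Ω : Type*} [m : MeasurableSpace Ω] {x : ℕ → Ω → Vec d} {t : ℕ}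
    (h : ∀ k, 1 ≤ k → Measurable (x k)) : past x t ≤ m :=
  iSup₂_le fun k hk => (h k (Finset.mem_Icc.mp hk).1).comap_le

/-- This packs the past into one random sequence, so that functions of the past become functions on
the fixed space `ℕ → Vec d`. -/
lemma measurable_past_clampIndex {d : ℕ} {Ω : Type*} (x : ℕ → Ω → Vec d) {t : ℕ} (ht : 1 ≤ t) :
    Measurable[past x t] (fun ω k => x (clampIndex t k) ω) := by
  refine @measurable_pi_lambda _ _ _ (past x t) _ _ fun k => ?_
  exact measurable_past x (le_max_left _ _) (by simp only [clampIndex]; omega)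

/-- The tower property with a weight `w` depending on the past. Working in `ENNReal` removes any
integrability question. -/
lemma HasStateKernel.lintegral_eq {d : ℕ} {Ω : Type*} [MeasurableSpace Ω] {μ : Measure Ω}
    [IsFiniteMeasure μ] {x z : ℕ → Ω → Vec d} {κ : Kernel (Vec d) (Vec d)} [IsMarkovKernel κ]
    (h : HasStateKernel μ x z κ) (hx : ∀ k, 1 ≤ k → Measurable (x k)) {t : ℕ} (ht : 1 ≤ t)
    (hz : Measurable (z t)) {w : (ℕ → Vec d) → ENNReal} (hw : Measurable w)
    {g : Vec d × Vec d → ENNReal} (hg : Measurable g) :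
    ∫⁻ ω, w (fun k => x (clampIndex t k) ω) * g (x t ω, z t ω) ∂μ =
      ∫⁻ ω, w (fun k => x (clampIndex t k) ω) * ∫⁻ u, g (x t ω, u) ∂κ (x t ω) ∂μ := by
  have hct : clampIndex t t = t := clampIndex_of_mem ht le_rfl
  have hX : Measurable (fun ω k => x (clampIndex t k) ω) :=
    (measurable_past_clampIndex x ht).mono (past_le hx) le_rfl
  have hev : Measurable (fun y : ℕ → Vec d => y t) := measurable_pi_apply t
  have key := lintegral_eq_lintegral_lintegral_of_forall_rect (μ := μ)
    (η := κ.comap (fun y : ℕ → Vec d => y t) hev) hX hz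
    (fun S B hS hB => by
      simp only [Kernel.comap_apply, hct]
      exact h t ht _ B (measurable_past_clampIndex x ht hS) hB)
    (g := fun p => w p.1 * g (p.1 t, p.2))
    ((hw.comp measurable_fst).mul (hg.comp ((hev.comp measurable_fst).prodMk measurable_snd)))
  simp only [Kernel.comap_apply, hct] at key
  rw [key]
  refine lintegral_congr fun ω => ?_
  exact lintegral_const_mul _ (hg.comp (measurable_const.prodMk measurable_id))

/-! ### The exponential supermartingale -/

/-- `min {‖v‖, ‖v‖²}`. -/
noncomputable def minNormSq {d : ℕ} (v : Vec d) : ℝ := min ‖v‖ (‖v‖ ^ 2)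

lemma minNormSq_nonneg {d : ℕ} (v : Vec d) : 0 ≤ minNormSq v := le_min (norm_nonneg _) (by positivity)

lemma continuous_minNormSq {d : ℕ} : Continuous (minNormSq (d := d)) :=
  continuous_norm.min (continuous_norm.pow 2)

lemma integrable_inner_of_bounded {d : ℕ} {Ω : Type*} [MeasurableSpace Ω] {ν : Measure Ω}
    [IsFiniteMeasure ν] {f : Ω → Vec d} {C : ℝ} (hf : Measurable f) (hC : ∀ x, ‖f x‖ ≤ C)
    (v : Vec d) : Integrable (fun z => inner ℝ (f z) v) ν :=
  Integrable.of_bound (hf.inner_const).aestronglyMeasurable (C * ‖v‖)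
    (ae_of_all _ fun z => (norm_inner_le_norm _ _).trans
      (mul_le_mul_of_nonneg_right (hC z) (norm_nonneg _)))

/-- Since `γ * ⟨Ψ, v⟩` is at most one in absolute value, `exp (-X) ≤ 1 - X + X²` applies. By `h2`
the quadratic term eats at most half of the drift, which is why `β / 2` appears; `1 - y ≤ exp (-y)`
closes the estimate. -/
lemma lintegral_exp_drift_le_one {d : ℕ} {ν : Measure (Vec d)} [IsProbabilityMeasure ν]
    {Ψ : Vec d → Vec d} {C β γ : ℝ} {v : Vec d} (hΨ : Measurable Ψ) (hC : ∀ x, ‖Ψ x‖ ≤ C)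
    (hγ : 0 ≤ γ) (hdrift : β * minNormSq v ≤ ∫ z, inner ℝ (Ψ (v + z)) v ∂ν)
    (h1 : γ * C * ‖v‖ ≤ 1) (h2 : γ * C ^ 2 * ‖v‖ ^ 2 ≤ β / 2 * minNormSq v) :
    ∫⁻ u, ENNReal.ofReal (Real.exp (γ * (β / 2 * minNormSq v - inner ℝ v (Ψ (v + u))))) ∂ν
      ≤ 1 := by
  have hm : Measurable fun u => Ψ (v + u) := hΨ.comp (measurable_const_add v)
  have hint := integrable_inner_of_bounded (ν := ν) hm (fun u => hC _) v
  have hpt : ∀ u, Real.exp (γ * (β / 2 * minNormSq v - inner ℝ v (Ψ (v + u)))) ≤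
      Real.exp (γ * (β / 2 * minNormSq v)) *
        (1 + (γ * C * ‖v‖) ^ 2 - γ * inner ℝ (Ψ (v + u)) v) := by
    intro u
    rw [real_inner_comm, mul_sub, sub_eq_add_neg, Real.exp_add]
    refine mul_le_mul_of_nonneg_left ?_ (Real.exp_nonneg _)
    have hb : |-(γ * inner ℝ (Ψ (v + u)) v)| ≤ γ * C * ‖v‖ := by
      rw [abs_neg, abs_mul, abs_of_nonneg hγ, mul_assoc]
      refine mul_le_mul_of_nonneg_left ?_ hγ
      exact (abs_real_inner_le_norm _ _).trans
        (mul_le_mul_of_nonneg_right (hC _) (norm_nonneg _))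
    have h3 := (abs_le.mp (Real.abs_exp_sub_one_sub_id_le (hb.trans h1))).2
    have h4 : (-(γ * inner ℝ (Ψ (v + u)) v)) ^ 2 ≤ (γ * C * ‖v‖) ^ 2 := by
      rw [← sq_abs]; exact pow_le_pow_left₀ (abs_nonneg _) hb 2
    linarith
  have hint2 : Integrable (fun u => Real.exp (γ * (β / 2 * minNormSq v)) *
        (1 + (γ * C * ‖v‖) ^ 2 - γ * inner ℝ (Ψ (v + u)) v)) ν :=
    ((integrable_const _).sub (hint.const_mul γ)).const_mul _
  calc _ ≤ ∫⁻ u, ENNReal.ofReal (Real.exp (γ * (β / 2 * minNormSq v)) *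
        (1 + (γ * C * ‖v‖) ^ 2 - γ * inner ℝ (Ψ (v + u)) v)) ∂ν :=
      lintegral_mono fun u => ENNReal.ofReal_le_ofReal (hpt u)
    _ = ENNReal.ofReal (∫ u, Real.exp (γ * (β / 2 * minNormSq v)) *
        (1 + (γ * C * ‖v‖) ^ 2 - γ * inner ℝ (Ψ (v + u)) v) ∂ν) :=
      (ofReal_integral_eq_lintegral_ofReal hint2
        (ae_of_all _ fun u => (Real.exp_nonneg _).trans (hpt u))).symm
    _ ≤ 1 := by
      rw [← ENNReal.ofReal_one]
      apply ENNReal.ofReal_le_ofReal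
      rw [integral_const_mul, integral_sub (integrable_const _) (hint.const_mul γ),
        integral_const_mul, integral_const, probReal_univ, one_smul]
      have h5 : 1 + (γ * C * ‖v‖) ^ 2 - γ * ∫ z, inner ℝ (Ψ (v + z)) v ∂ν ≤
          Real.exp (-(γ * (β / 2 * minNormSq v))) := by
        refine le_trans ?_ (Real.add_one_le_exp _)
        have h6 := mul_le_mul_of_nonneg_left hdrift hγ
        have h7 := mul_le_mul_of_nonneg_left h2 hγ
        nlinarith
      calc _ ≤ Real.exp (γ * (β / 2 * minNormSq v)) *
            Real.exp (-(γ * (β / 2 * minNormSq v))) :=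
            mul_le_mul_of_nonneg_left h5 (Real.exp_nonneg _)
        _ = 1 := by rw [← Real.exp_add, add_neg_cancel, Real.exp_zero]

/-- The accumulated gap between (half of) the expected drift and the realized drift. -/
noncomputable def driftGap {d : ℕ} (F : Vec d → ℝ) (β : ℝ) (α : ℕ → ℝ) (t : ℕ) (y : ℕ → Vec d) : ℝ :=
  ∑ k ∈ Finset.Ico 1 t, (β / 2 * α k * minNormSq (gradient F (y k))
    - inner ℝ (gradient F (y k)) (y k - y (k + 1)))

lemma measurable_driftGap {d : ℕ} {F : Vec d → ℝ} (hF : Continuous (gradient F)) (β : ℝ)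
    (α : ℕ → ℝ) (t : ℕ) : Measurable (driftGap F β α t) := by
  have : Continuous (driftGap F β α t) := by
    refine continuous_finsetSum _ fun k _ => Continuous.sub ?_ ?_
    · exact continuous_const.mul (continuous_minNormSq.comp (hF.comp (continuous_apply k)))
    · exact (hF.comp (continuous_apply k)).inner
        ((continuous_apply k).sub (continuous_apply (k + 1)))
  exact this.measurable

/-- The realized drift is expressed through increments of the path, not through the noise, so the
gap up to `t` depends only on the first `t` iterates. -/
lemma driftGap_clampIndex {d : ℕ} (F : Vec d → ℝ) (β : ℝ) (α : ℕ → ℝ) (t : ℕ) (y : ℕ → Vec d) :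
    driftGap F β α t (fun k => y (clampIndex t k)) = driftGap F β α t y := by
  refine Finset.sum_congr rfl fun k hk => ?_
  have hk := Finset.mem_Ico.mp hk
  simp only [clampIndex_of_mem hk.1 hk.2.le, clampIndex_of_mem (t := t) (k := k + 1) (by omega) hk.2]

/-- The supermartingale step: given the past, the newest factor has mean at most one by
`lintegral_exp_drift_le_one` with `γ = l * α t`. -/
lemma lintegral_exp_driftGap_le_one {d : ℕ} {Ω : Type*} [MeasurableSpace Ω] {μ : Measure Ω}
    [IsProbabilityMeasure μ] {x z : ℕ → Ω → Vec d} {κ : Kernel (Vec d) (Vec d)}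
    [IsMarkovKernel κ] {F : Vec d → ℝ} {Ψ : Vec d → Vec d} {C β l : ℝ} {α : ℕ → ℝ}
    (hF : Continuous (gradient F)) (hΨ : Measurable Ψ) (hC : ∀ x, ‖Ψ x‖ ≤ C) (hl : 0 ≤ l)
    (hα : ∀ t, 0 ≤ α t)
    (hdrift : ∀ y v, β * minNormSq v ≤ ∫ z, inner ℝ (Ψ (v + z)) v ∂κ y)
    (hx : ∀ k, 1 ≤ k → Measurable (x k)) (hz : ∀ k, 1 ≤ k → Measurable (z k))
    (hstep : ∀ t, 1 ≤ t → ∀ ω, x (t + 1) ω = x t ω - α t • Ψ (gradient F (x t ω) + z t ω))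
    (hκ : HasStateKernel μ x z κ)
    (h1 : ∀ t, 1 ≤ t → ∀ ω, l * α t * C * ‖gradient F (x t ω)‖ ≤ 1)
    (h2 : ∀ t, 1 ≤ t → ∀ ω, l * α t * C ^ 2 * ‖gradient F (x t ω)‖ ^ 2 ≤
      β / 2 * minNormSq (gradient F (x t ω))) {t : ℕ} (ht : 1 ≤ t) :
    ∫⁻ ω, ENNReal.ofReal (Real.exp (l * driftGap F β α t (fun k => x k ω))) ∂μ ≤ 1 := by
  induction t, ht using Nat.le_induction with
  | base => simp [driftGap]
  | succ t ht ih =>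
    have hmeas : Measurable fun p : Vec d × Vec d => ENNReal.ofReal (Real.exp (l * α t *
        (β / 2 * minNormSq (gradient F p.1)
          - inner ℝ (gradient F p.1) (Ψ (gradient F p.1 + p.2))))) := by
      have hg : Measurable fun p : Vec d × Vec d => gradient F p.1 :=
        hF.measurable.comp measurable_fst
      exact ((((continuous_minNormSq.measurable.comp hg).const_mul _).sub
        (hg.inner (hΨ.comp (hg.add measurable_snd)))).const_mul _).exp.ennreal_ofReal
    have hw : Measurable fun y : ℕ → Vec d =>
        ENNReal.ofReal (Real.exp (l * driftGap F β α t y)) :=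
      ((measurable_driftGap hF β α t).const_mul l).exp.ennreal_ofReal
    have key := hκ.lintegral_eq hx ht (hz t ht) hw hmeas
    refine le_trans (le_of_eq ?_) (key.le.trans (le_trans ?_ ih))
    · refine lintegral_congr fun ω => ?_
      have e : driftGap F β α t (fun k => x (clampIndex t k) ω) =
        driftGap F β α t (fun k => x k ω) := driftGap_clampIndex F β α t fun k => x k ω
      rw [e, ← ENNReal.ofReal_mul (Real.exp_nonneg _), ← Real.exp_add]
      congr 2
      rw [driftGap, Finset.sum_Ico_succ_top ht, ← driftGap, hstep t ht ω, sub_sub_cancel,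
        inner_smul_right]
      ring
    · refine lintegral_mono fun ω => ?_
      have e : driftGap F β α t (fun k => x (clampIndex t k) ω) =
        driftGap F β α t (fun k => x k ω) := driftGap_clampIndex F β α t fun k => x k ω
      simp only [e]
      refine (mul_le_mul_right (lintegral_exp_drift_le_one hΨ hC (mul_nonneg hl (hα t))
        (hdrift _ _) (h1 t ht ω) (h2 t ht ω)) _).trans ?_
      rw [mul_one]

/-! ### The rate -/

/-- The optimality gap along a run bounds the weighted sum of the squared gradients. -/
lemma sum_minNormSq_le {d : ℕ} {F : Vec d → ℝ} {L C Δ β r a : ℝ} {y : ℕ → Vec d}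
    {p : ℕ → Vec d} (hF : IsSmoothCost F L) (hL : 0 ≤ L) (hΔ : F (y 1) - ⨅ y, F y ≤ Δ)
    (hp : ∀ k, ‖p k‖ ≤ C)
    (hstep : ∀ k, 1 ≤ k → y (k + 1) = y k - stepSize a (1 / 2) k • p k) {t : ℕ}
    (hgap : driftGap F β (stepSize a (1 / 2)) (t + 1) y ≤ r) :
    ∑ k ∈ Finset.Ico 1 (t + 1), β / 2 * stepSize a (1 / 2) k * minNormSq (gradient F (y k)) ≤
      Δ + L * C ^ 2 * a ^ 2 * Real.log (t + 1) + r := by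
  have hC : 0 ≤ C := (norm_nonneg _).trans (hp 0)
  have h1 : ∀ k ∈ Finset.Ico 1 (t + 1), inner ℝ (gradient F (y k)) (y k - y (k + 1)) ≤
      (F (y k) - F (y (k + 1))) + L * C ^ 2 * a ^ 2 * (1 / ((k : ℝ) + 1)) := by
    intro k hk
    have h := hF.le_add_inner hL (y k) (y (k + 1))
    have e : ‖y (k + 1) - y k‖ ^ 2 ≤ C ^ 2 * (a ^ 2 * (1 / ((k : ℝ) + 1))) := by
      rw [hstep k (Finset.mem_Ico.mp hk).1, sub_sub_cancel_left, norm_neg, norm_smul, mul_pow,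
        Real.norm_eq_abs, sq_abs, stepSize_half, div_pow, Real.sq_sqrt (by positivity), mul_comm,
        ← div_eq_mul_one_div]
      exact mul_le_mul_of_nonneg_right (pow_le_pow_left₀ (norm_nonneg _) (hp k) 2)
        (by positivity)
    rw [← neg_sub (y (k + 1)), inner_neg_right]
    nlinarith [mul_le_mul_of_nonneg_left e hL]
  have h2 := Finset.sum_le_sum h1
  rw [Finset.sum_add_distrib, ← Finset.mul_sum] at h2
  have h3 : ∑ k ∈ Finset.Ico 1 (t + 1), (F (y k) - F (y (k + 1))) = F (y 1) - F (y (t + 1)) := by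
    have := Finset.sum_Ico_sub (fun k => -F (y k)) (show 1 ≤ t + 1 by omega)
    simp only [sub_neg_eq_add, neg_add_eq_sub] at this
    rw [this]
  have h4 := mul_le_mul_of_nonneg_left (sum_inv_succ_le_log t)
    (show 0 ≤ L * C ^ 2 * a ^ 2 by positivity)
  have h5 := ciInf_le hF.bddBelow (y (t + 1))
  rw [driftGap, Finset.sum_sub_distrib] at hgap
  linarith

/-- A bounded update direction and the decaying step-sizes keep the gradients of order `√t`. -/
lemma norm_gradient_le_of_steps {d : ℕ} {F : Vec d → ℝ} {L C G a : ℝ} {y p : ℕ → Vec d}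
    (hF : IsSmoothCost F L) (hL : 0 ≤ L) (ha : 0 ≤ a) (hG : ‖gradient F (y 1)‖ ≤ G)
    (hp : ∀ k, ‖p k‖ ≤ C)
    (hstep : ∀ k, 1 ≤ k → y (k + 1) = y k - stepSize a (1 / 2) k • p k) {t : ℕ} (ht : 1 ≤ t) :
    ‖gradient F (y t)‖ ≤ G + 2 * L * C * a * √(t : ℝ) := by
  have hC : 0 ≤ C := (norm_nonneg _).trans (hp 0)
  have h : ‖gradient F (y t)‖ ≤
      G + L * C * a * ∑ k ∈ Finset.Ico 1 t, 1 / √((k : ℝ) + 1) := by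
    induction t, ht using Nat.le_induction with
    | base => simpa using hG
    | succ t ht ih =>
      rw [Finset.sum_Ico_succ_top ht]
      have h1 := hF.lipschitz_gradient (y (t + 1)) (y t)
      rw [hstep t ht, sub_sub_cancel_left, norm_neg, norm_smul, stepSize_half,
        Real.norm_of_nonneg (by positivity), ← stepSize_half, ← hstep t ht, stepSize_half] at h1
      have h2 : a / √((t : ℝ) + 1) * ‖p t‖ ≤ a / √((t : ℝ) + 1) * C :=
        mul_le_mul_of_nonneg_left (hp t) (by positivity)
      have h3 := mul_le_mul_of_nonneg_left h2 hL
      have h4 := norm_le_insert' (gradient F (y (t + 1))) (gradient F (y t))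
      have e : L * (a / √((t : ℝ) + 1) * C) = L * C * a * (1 / √((t : ℝ) + 1)) := by ring
      rw [mul_add]
      linarith
  have h2 := mul_le_mul_of_nonneg_left (sum_inv_sqrt_succ_le t)
    (show 0 ≤ L * C * a by positivity)
  linarith

/-- The growth of the gradients and the decay of the step-sizes cancel; this is what allows one
exponent `l` for all times and any `a > 0`. -/
lemma stepSize_mul_norm_gradient_le {d : ℕ} {F : Vec d → ℝ} {L C G a : ℝ} {y p : ℕ → Vec d}
    (hF : IsSmoothCost F L) (hL : 0 ≤ L) (ha : 0 ≤ a) (hG : ‖gradient F (y 1)‖ ≤ G)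
    (hp : ∀ k, ‖p k‖ ≤ C)
    (hstep : ∀ k, 1 ≤ k → y (k + 1) = y k - stepSize a (1 / 2) k • p k) {t : ℕ} (ht : 1 ≤ t) :
    stepSize a (1 / 2) t * ‖gradient F (y t)‖ ≤ a * (G + 2 * L * C * a) := by
  have hC : 0 ≤ C := (norm_nonneg _).trans (hp 0)
  have hG0 : 0 ≤ G := (norm_nonneg _).trans hG
  have h := norm_gradient_le_of_steps hF hL ha hG hp hstep ht
  have h1 : 1 ≤ √((t : ℝ) + 1) := Real.one_le_sqrt.mpr (by linarith [(t.cast_nonneg : (0 : ℝ) ≤ t)])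
  have h2 : √(t : ℝ) ≤ √((t : ℝ) + 1) := Real.sqrt_le_sqrt (by linarith)
  rw [stepSize_half, div_mul_eq_mul_div, div_le_iff₀ (by linarith), mul_assoc]
  refine mul_le_mul_of_nonneg_left (h.trans ?_) ha
  rw [add_mul]
  refine add_le_add (le_mul_of_one_le_right hG0 h1) (mul_le_mul_of_nonneg_left h2 (by positivity))

lemma minSqGrad_le_of_driftGap_le {d : ℕ} {F : Vec d → ℝ} {L C Δ β l a G : ℝ} {y : ℕ → Vec d}
    {p : ℕ → Vec d} (hF : IsSmoothCost F L) (hL : 0 ≤ L) (hβ : 0 < β) (ha : 0 < a) (hl : 0 < l)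
    (hΔ0 : 0 ≤ Δ) (hΔ : F (y 1) - ⨅ y, F y ≤ Δ) (hG1 : 1 ≤ G) (hG : ‖gradient F (y 1)‖ ^ 2 ≤ G)
    (hp : ∀ k, ‖p k‖ ≤ C)
    (hstep : ∀ k, 1 ≤ k → y (k + 1) = y k - stepSize a (1 / 2) k • p k) {t : ℕ} (ht : 2 ≤ t)
    {δ : ℝ} (hδ : 0 < δ) (hδ1 : δ < 1)
    (hgap : l * driftGap F β (stepSize a (1 / 2)) (t + 1) y ≤ Real.log (1 / δ)) :
    minSqGrad F y t ≤ 4 / (β * a) * (2 * Δ + 2 * L * C ^ 2 * a ^ 2 + 1 / l) * G *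
      (Real.log (t / δ) / √(t : ℝ)) := by
  have hC : 0 ≤ C := (norm_nonneg _).trans (hp 0)
  have ht' : (2 : ℝ) ≤ t := by exact_mod_cast ht
  set D := 2 * Δ + 2 * L * C ^ 2 * a ^ 2 + 1 / l with hD
  have hD0 : 0 < D := by positivity
  have hlδ : 0 < Real.log (1 / δ) := Real.log_pos (by rw [lt_div_iff₀ hδ]; linarith)
  have hlog : Real.log (t / δ) = Real.log t + Real.log (1 / δ) := by
    rw [div_eq_mul_one_div, Real.log_mul (by positivity) (by positivity)]
  -- `log t ≥ 1/2` lets `2 * Δ * log t` absorb the constant `Δ`; below, `t + 1 ≤ t ^ 2` gives `log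
  -- (t + 1) ≤ 2 * log t`.
  have hlt : 1 / 2 ≤ Real.log t := by
    have := Real.log_le_log (by norm_num) ht'
    linarith [Real.log_two_gt_d9]
  have hgap' : driftGap F β (stepSize a (1 / 2)) (t + 1) y ≤ 1 / l * Real.log (1 / δ) := by
    rw [one_div_mul_eq_div, le_div_iff₀ hl]; linarith
  have hsum := sum_minNormSq_le hF hL hΔ hp hstep hgap'
  have hlog1 : Real.log ((t : ℝ) + 1) ≤ 2 * Real.log t := by
    rw [← Real.log_rpow (by positivity)]
    refine Real.log_le_log (by positivity) ?_
    norm_num; nlinarith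
  have hsum2 : ∑ k ∈ Finset.Ico 1 (t + 1),
      β / 2 * stepSize a (1 / 2) k * minNormSq (gradient F (y k)) ≤ D * Real.log (t / δ) := by
    refine hsum.trans ?_
    rw [hlog, hD]
    have hc : 0 ≤ L * C ^ 2 * a ^ 2 := by positivity
    have hl' : 0 < 1 / l := by positivity
    have h1 := mul_le_mul_of_nonneg_left hlog1 hc
    have h2 := mul_le_mul_of_nonneg_left hlt hΔ0
    have h3 : 0 ≤ Δ * Real.log (1 / δ) := by positivity
    have h4 : 0 ≤ L * C ^ 2 * a ^ 2 * Real.log (1 / δ) := by positivity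
    have h5 : 0 ≤ 1 / l * Real.log t := by positivity
    linarith
  have hst : 0 < √(t : ℝ) := by positivity
  set R := 4 / (β * a) * D * (Real.log (t / δ) / √(t : ℝ)) with hR
  have hlogpos : 0 < Real.log (t / δ) := by rw [hlog]; linarith
  have hR0 : 0 < R := by positivity
  have hgoal : 4 / (β * a) * D * G * (Real.log (t / δ) / √(t : ℝ)) = R * G := by rw [hR]; ring
  rw [hgoal]
  -- If `R ≤ 1`, averaging yields an iterate with `minNormSq ≤ R`, and either branch of the minimum
  -- gives `‖∇F‖² ≤ R`. If `R > 1`, the first iterate already satisfies the bound, through `G`.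
  rcases le_or_gt R 1 with hR1 | hR1
  · obtain ⟨k, hk, hkR⟩ : ∃ k ∈ Finset.Ico 1 (t + 1), minNormSq (gradient F (y k)) ≤ R := by
      by_contra! hcon
      have hs : ∀ k ∈ Finset.Ico 1 (t + 1), β / 2 * stepSize a (1 / 2) k * R <
          β / 2 * stepSize a (1 / 2) k * minNormSq (gradient F (y k)) := fun k hk =>
        mul_lt_mul_of_pos_left (hcon k hk) (by rw [stepSize_half]; positivity)
      have h1 := Finset.sum_lt_sum_of_nonempty ⟨1, by simp; omega⟩ hs
      have h2 : ∑ k ∈ Finset.Ico 1 (t + 1), β / 2 * stepSize a (1 / 2) k * R =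
          β / 2 * a * R * ∑ k ∈ Finset.Ico 1 (t + 1), 1 / √((k : ℝ) + 1) := by
        rw [Finset.mul_sum]
        refine Finset.sum_congr rfl fun k _ => ?_
        rw [stepSize_half]; ring
      have h3 := mul_le_mul_of_nonneg_left (sqrt_le_sum_inv_sqrt_succ (show 1 ≤ t by omega))
        (show 0 ≤ β / 2 * a * R by positivity)
      have h4 : β / 2 * a * R * (√(t : ℝ) / 2) = D * Real.log (t / δ) := by
        rw [hR]; field_simp; norm_num
      linarith
    have hk' := Finset.mem_Ico.mp hk
    refine (minSqGrad_le hk'.1 (Nat.lt_succ_iff.mp hk'.2)).trans ?_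
    have h1 : ‖gradient F (y k)‖ ^ 2 ≤ R := by
      rcases min_le_iff.mp hkR with h | h
      · nlinarith [norm_nonneg (gradient F (y k))]
      · exact h
    exact h1.trans (le_mul_of_one_le_right hR0.le hG1)
  · exact (minSqGrad_le le_rfl (by omega)).trans
      (hG.trans (le_mul_of_one_le_left (by linarith) hR1.le))

/-- The high-probability rate of bounded nonlinear updates whose expected direction, under
every conditional law of the noise, is aligned with the gradient. -/
theorem exists_hasRate_of_drift {d : ℕ} {κ : Kernel (Vec d) (Vec d)} [IsMarkovKernel κ]
    {Ψ : Vec d → Vec d} {C β : ℝ} (hΨ : Measurable Ψ) (hC : ∀ x, ‖Ψ x‖ ≤ C) (hC0 : 0 < C)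
    (hβ : 0 < β) (hdrift : ∀ y v, β * minNormSq v ≤ ∫ z, inner ℝ (Ψ (v + z)) v ∂κ y)
    (L Δ a : ℝ) (ha : 0 < a) :
    ∃ M > 0, ∀ (F : Vec d → ℝ) (x₁ : Vec d), IsSmoothCost F L → F x₁ - ⨅ y, F y ≤ Δ →
      ∀ (Ω : Type*) [MeasurableSpace Ω] (μ : Measure Ω) [IsProbabilityMeasure μ]
        (x z : ℕ → Ω → Vec d), (∀ ω, x 1 ω = x₁) →
        (∀ t, 1 ≤ t → ∀ ω,
          x (t + 1) ω = x t ω - stepSize a (1 / 2) t • Ψ (gradient F (x t ω) + z t ω)) →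
        (∀ k, 1 ≤ k → Measurable (x k)) → (∀ k, 1 ≤ k → Measurable (z k)) →
        HasStateKernel μ x z κ → HasRate μ F x M := by
  -- Enlarging `L` and `Δ` to at least one makes all constants positive and `G ≥ 1`, so that `G`
  -- bounds both the norm of the initial gradient and its square.
  set L' := max L 1 with hL'
  set Δ' := max Δ 1 with hΔ'
  have hL1 : 1 ≤ L' := le_max_right _ _
  have hΔ1 : 1 ≤ Δ' := le_max_right _ _
  set G := 4 * L' * Δ' with hGdef
  have hG1 : 1 ≤ G := by nlinarith
  set B := a * (G + 2 * L' * C * a) with hB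
  have hB0 : 0 < B := by positivity
  -- The first entry keeps the exponents at most one; the other two make the quadratic term at most
  -- half the drift, for the branches `‖v‖` and `‖v‖²` of `minNormSq`.
  set l := min (1 / (B * C)) (min (β / (2 * B * C ^ 2)) (β / (2 * a * C ^ 2))) with hldef
  have hl : 0 < l := by positivity
  have hl1 : l * (B * C) ≤ 1 := by
    rw [← le_div_iff₀ (by positivity)]; exact min_le_left _ _
  have hl2 : l * (2 * B * C ^ 2) ≤ β := by
    rw [← le_div_iff₀ (by positivity)]; exact (min_le_right _ _).trans (min_le_left _ _)
  have hl3 : l * (2 * a * C ^ 2) ≤ β := by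
    rw [← le_div_iff₀ (by positivity)]; exact (min_le_right _ _).trans (min_le_right _ _)
  refine ⟨4 / (β * a) * (2 * Δ' + 2 * L' * C ^ 2 * a ^ 2 + 1 / l) * G, by positivity, ?_⟩
  intro F x₁ hF hFΔ Ω _ μ _ x z hx1 hstep hx hz hκ t ht δ hδ hδ1
  replace hF := hF.mono (le_max_left L 1)
  replace hFΔ : F x₁ - ⨅ y, F y ≤ Δ' := hFΔ.trans (le_max_left _ _)
  have hG : ‖gradient F x₁‖ ^ 2 ≤ G := (hF.sq_norm_gradient_le (by linarith) x₁).trans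
    (mul_le_mul_of_nonneg_left hFΔ (by positivity))
  have hG' : ‖gradient F x₁‖ ≤ G := by nlinarith [norm_nonneg (gradient F x₁)]
  have hαa : ∀ k, stepSize a (1 / 2) k ≤ a := fun k => by
    rw [stepSize_half]
    exact div_le_self ha.le (Real.one_le_sqrt.mpr (by linarith [(k.cast_nonneg : (0 : ℝ) ≤ k)]))
  have hα0 : ∀ k, 0 ≤ stepSize a (1 / 2) k := fun k => by rw [stepSize_half]; positivity
  have hbd : ∀ k, 1 ≤ k → ∀ ω, stepSize a (1 / 2) k * ‖gradient F (x k ω)‖ ≤ B :=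
    fun k hk ω => stepSize_mul_norm_gradient_le (y := fun k => x k ω)
      (p := fun k => Ψ (gradient F (x k ω) + z k ω)) hF (by linarith) ha.le
      (by rw [hx1]; exact hG') (fun _ => hC _) (fun k hk => hstep k hk ω) hk
  have hexp := lintegral_exp_driftGap_le_one hF.continuous_gradient hΨ hC hl.le hα0 hdrift hx hz
    hstep hκ
    (fun k hk ω => by
      calc _ = l * C * (stepSize a (1 / 2) k * ‖gradient F (x k ω)‖) := by ring
        _ ≤ l * C * B := mul_le_mul_of_nonneg_left (hbd k hk ω) (by positivity)
        _ ≤ 1 := by linarith)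
    (fun k hk ω => by
      rw [minNormSq, mul_min_of_nonneg _ _ (by positivity)]
      refine le_min ?_ ?_
      · calc _ = l * C ^ 2 * (stepSize a (1 / 2) k * ‖gradient F (x k ω)‖) *
              ‖gradient F (x k ω)‖ := by ring
          _ ≤ β / 2 * ‖gradient F (x k ω)‖ := by
            refine mul_le_mul_of_nonneg_right ?_ (norm_nonneg _)
            have := mul_le_mul_of_nonneg_left (hbd k hk ω) (show 0 ≤ l * C ^ 2 by positivity)
            linarith
      · refine mul_le_mul_of_nonneg_right ?_ (by positivity)
        have := mul_le_mul_of_nonneg_left (hαa k) (show 0 ≤ l * C ^ 2 by positivity)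
        linarith)
    (show 1 ≤ t + 1 by omega)
  set f := fun ω => ENNReal.ofReal
    (Real.exp (l * driftGap F β (stepSize a (1 / 2)) (t + 1) (fun k => x k ω))) with hf
  have hbad : μ {ω | ENNReal.ofReal (1 / δ) ≤ f ω} ≤ ENNReal.ofReal δ := by
    have hmf : Measurable f := by
      -- The variable `x 0` is not assumed measurable; clamping the index removes it from the path.
      have : f = fun ω => ENNReal.ofReal (Real.exp (l * driftGap F β (stepSize a (1 / 2)) (t + 1)
          (fun k => x (clampIndex (t + 1) k) ω))) := by
        funext ω
        rw [hf, driftGap_clampIndex F β (stepSize a (1 / 2)) (t + 1) fun k => x k ω]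
      rw [this]
      exact (((measurable_driftGap hF.continuous_gradient _ _ _).comp
        ((measurable_past_clampIndex x (by omega)).mono (past_le hx) le_rfl)).const_mul
          l).exp.ennreal_ofReal
    refine (meas_ge_le_lintegral_div hmf.aemeasurable (by simpa using hδ)
      ENNReal.ofReal_ne_top).trans ?_
    refine (ENNReal.div_le_div_right hexp _).trans (le_of_eq ?_)
    rw [one_div δ, ENNReal.ofReal_inv_of_pos hδ, one_div, inv_inv]
  have hgood : {ω | ENNReal.ofReal (1 / δ) ≤ f ω}ᶜ ⊆ {ω | minSqGrad F (fun k => x k ω) t ≤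
      4 / (β * a) * (2 * Δ' + 2 * L' * C ^ 2 * a ^ 2 + 1 / l) * G *
        (Real.log (t / δ) / √(t : ℝ))} := by
    intro ω hω
    simp only [Set.mem_compl_iff, Set.mem_ofPred_eq, not_le, hf] at hω
    rw [ENNReal.ofReal_lt_ofReal_iff (by positivity)] at hω
    refine minSqGrad_le_of_driftGap_le (p := fun k => Ψ (gradient F (x k ω) + z k ω)) hF
      (by linarith) hβ ha hl (by linarith) (by rw [hx1]; exact hFΔ) hG1 (by rw [hx1]; exact hG)
      (fun _ => hC _) (fun k hk => hstep k hk ω) ht hδ hδ1 ?_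
    rw [Real.le_log_iff_exp_le (by positivity)]
    exact hω.le
  refine le_trans ?_ (measure_mono hgood)
  have h1 : 1 ≤ μ {ω | ENNReal.ofReal (1 / δ) ≤ f ω} + μ {ω | ENNReal.ofReal (1 / δ) ≤ f ω}ᶜ := by
    rw [← measure_univ (μ := μ), ← Set.union_compl_self {ω | ENNReal.ofReal (1 / δ) ≤ f ω}]
    exact measure_union_le _ _
  rw [ENNReal.ofReal_sub _ hδ.le, ENNReal.ofReal_one, tsub_le_iff_left]
  exact h1.trans (add_le_add_left hbad _)

/-! ### Symmetrized drift -/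

/-- Twice the symmetrization in `z` of `⟨Ψ(v + z), v⟩`. -/
noncomputable def symDrift {d : ℕ} (Ψ : Vec d → Vec d) (v z : Vec d) : ℝ :=
  inner ℝ (Ψ (v + z)) v + inner ℝ (Ψ (v - z)) v

section symDrift

variable {d : ℕ} {Ψ : Vec d → Vec d} {C : ℝ} {ν : Measure (Vec d)}

lemma integrable_symDrift [IsFiniteMeasure ν] (hΨ : Measurable Ψ) (hC : ∀ x, ‖Ψ x‖ ≤ C)
    (v : Vec d) : Integrable (symDrift Ψ v) ν :=
  (integrable_inner_of_bounded (hΨ.comp (measurable_const_add v)) (fun _ => hC _) v).add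
    (integrable_inner_of_bounded (hΨ.comp (measurable_const.sub measurable_id)) (fun _ => hC _) v)

lemma integral_symDrift [IsFiniteMeasure ν] [ν.IsNegInvariant] (hΨ : Measurable Ψ)
    (hC : ∀ x, ‖Ψ x‖ ≤ C) (v : Vec d) :
    ∫ z, symDrift Ψ v z ∂ν = 2 * ∫ z, inner ℝ (Ψ (v + z)) v ∂ν := by
  have h1 := integrable_inner_of_bounded (ν := ν) (f := fun z => Ψ (v + z))
    (hΨ.comp (measurable_const_add v)) (fun _ => hC _) v
  have h2 := integrable_inner_of_bounded (ν := ν) (f := fun z => Ψ (v - z))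
    (hΨ.comp (measurable_const.sub measurable_id)) (fun _ => hC _) v
  have h3 : ∫ z, inner ℝ (Ψ (v - z)) v ∂ν = ∫ z, inner ℝ (Ψ (v + z)) v ∂ν := by
    rw [← integral_neg_eq_self (fun z => inner ℝ (Ψ (v + z)) v) ν]
    simp only [sub_eq_add_neg]
  simp only [symDrift]
  rw [integral_add h1 h2, h3]
  ring

lemma mul_measureReal_le_integral [IsFiniteMeasure ν] {h : Vec d → ℝ} (h0 : ∀ z, 0 ≤ h z)
    (hint : Integrable h ν) {c : ℝ} (hc : 0 ≤ c) {S : Set (Vec d)} (hS : ∀ z ∈ S, c ≤ h z) :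
    c * ν.real S ≤ ∫ z, h z ∂ν :=
  (mul_le_mul_of_nonneg_left (measureReal_mono hS) hc).trans
    (mul_meas_ge_le_integral_of_nonneg (ae_of_all _ h0) hint c)

end symDrift

/-- All balls of the same radius near the origin have a uniformly positive probability. -/
def UniformlyPositive {d : ℕ} (κ : Kernel (Vec d) (Vec d)) : Prop :=
  ∃ E > 0, ∀ r > 0, ∃ c > 0, ∀ y p, Metric.ball p r ⊆ Metric.ball (0 : Vec d) E →
    c ≤ (κ y).real (Metric.ball p r)

/-- A drift bound on balls near the origin gives a drift bound for the means. -/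
lemma UniformlyPositive.exists_drift {d : ℕ} {κ : Kernel (Vec d) (Vec d)} [IsMarkovKernel κ]
    [∀ y, (κ y).IsNegInvariant] {Ψ : Vec d → Vec d} {C : ℝ} (hκ : UniformlyPositive κ)
    (hΨ : Measurable Ψ) (hC : ∀ x, ‖Ψ x‖ ≤ C) (h0 : ∀ v z, 0 ≤ symDrift Ψ v z)
    (h : ∀ E > 0, ∃ r > 0, ∃ b > 0, ∀ v : Vec d, v ≠ 0 → ∃ p : Vec d,
      Metric.ball p r ⊆ Metric.ball (0 : Vec d) E ∧
        ∀ z ∈ Metric.ball p r, b * minNormSq v ≤ symDrift Ψ v z) :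
    ∃ β > 0, ∀ y v, β * minNormSq v ≤ ∫ z, inner ℝ (Ψ (v + z)) v ∂κ y := by
  obtain ⟨E, hE, hκ⟩ := hκ
  obtain ⟨r, hr, b, hb, h⟩ := h E hE
  obtain ⟨c, hc, hκ⟩ := hκ r hr
  refine ⟨b * c / 2, by positivity, fun y v => ?_⟩
  by_cases hv : v = 0
  · simp [hv, minNormSq]
  obtain ⟨p, hp, hpb⟩ := h v hv
  have h1 := mul_measureReal_le_integral (ν := κ y) (h0 v) (integrable_symDrift hΨ hC v)
    (mul_nonneg hb.le (minNormSq_nonneg v)) hpb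
  rw [integral_symDrift hΨ hC v] at h1
  have h2 := mul_le_mul_of_nonneg_left (hκ y p hp) (mul_nonneg hb.le (minNormSq_nonneg v))
  linarith

/-! ### Joint nonlinearities -/

section Joint

variable {d : ℕ} {Ψ : Vec d → Vec d} {φ : ℝ → ℝ}

/-- `r * φ r`, extended by zero, is monotone and hence measurable; the value `φ 0` is irrelevant
because it multiplies the zero vector. -/
lemma IsJoint.measurable (h : IsJoint Ψ φ) (hφ : JointCond d φ) : Measurable Ψ := by
  classical
  set ρ : ℝ → ℝ := fun r => if 0 < r then r * φ r else 0 with hρ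
  have hmono : Monotone ρ := by
    intro r s hrs
    simp only [hρ]
    split_ifs with h1 h2 h2
    · exact hφ.mul_monotone h1 h2 hrs
    · exact absurd (h1.trans_le hrs) h2
    · exact (mul_pos h2 (hφ.pos s h2)).le
    · exact le_rfl
  have e : Ψ = fun x => (ρ ‖x‖ / ‖x‖) • x := by
    funext x
    rw [h x]
    by_cases hx : x = 0
    · simp [hx]
    · have hx' : 0 < ‖x‖ := norm_pos_iff.mpr hx
      simp only [hρ, hx', if_true]
      rw [mul_div_cancel_left₀ _ hx'.ne']
  rw [e]
  exact ((hmono.measurable.comp measurable_norm).div measurable_norm).smul measurable_id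

/-- With `A = v + z`, `B = v - z` and `v = (A + B) / 2`, the difference of the two sides is `(‖A‖ -
‖B‖) * (‖A‖ φ(‖A‖) - ‖B‖ φ(‖B‖))`, nonnegative by monotonicity of `r φ(r)`. The lower bound is
itself nonnegative by Cauchy–Schwarz. -/
lemma IsJoint.le_symDrift (h : IsJoint Ψ φ) (hφ : JointCond d φ) (v z : Vec d) :
    (φ ‖v + z‖ + φ ‖v - z‖) * (inner ℝ (v + z) (v - z) + ‖v + z‖ * ‖v - z‖) ≤
      2 * symDrift Ψ v z := by
  set A := v + z with hA
  set B := v - z with hB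
  have hv : v = (1 / 2 : ℝ) • (A + B) := by
    rw [hA, hB, add_add_sub_cancel, ← two_smul ℝ v, smul_smul]; norm_num
  have e : 2 * symDrift Ψ v z = φ ‖A‖ * ‖A‖ ^ 2 + φ ‖B‖ * ‖B‖ ^ 2 +
      (φ ‖A‖ + φ ‖B‖) * inner ℝ A B := by
    rw [symDrift, ← hA, ← hB, h A, h B]
    clear_value A B
    rw [hv, inner_smul_left, inner_smul_left, inner_smul_right,
      inner_smul_right, inner_add_right, inner_add_right, real_inner_self_eq_norm_sq,
      real_inner_self_eq_norm_sq, real_inner_comm A B]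
    simp only [conj_trivial]
    ring
  rw [e]
  have key : 0 ≤ (‖A‖ - ‖B‖) * (‖A‖ * φ ‖A‖ - ‖B‖ * φ ‖B‖) := by
    have aux : ∀ a : ℝ, 0 ≤ a → 0 ≤ a * φ a := fun a ha => by
      rcases ha.eq_or_lt with rfl | ha
      · simp
      · exact (mul_pos ha (hφ.pos a ha)).le
    rcases (norm_nonneg A).eq_or_lt with hA0 | hA0
    · rw [← hA0]; nlinarith [aux ‖B‖ (norm_nonneg _), norm_nonneg B]
    rcases (norm_nonneg B).eq_or_lt with hB0 | hB0
    · rw [← hB0]; nlinarith [aux ‖A‖ (norm_nonneg _), norm_nonneg A]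
    rcases le_total ‖A‖ ‖B‖ with hAB | hAB
    · exact mul_nonneg_of_nonpos_of_nonpos (sub_nonpos.mpr hAB)
        (sub_nonpos.mpr (hφ.mul_monotone hA0 hB0 hAB))
    · exact mul_nonneg (sub_nonneg.mpr hAB) (sub_nonneg.mpr (hφ.mul_monotone hB0 hA0 hAB))
  nlinarith

lemma IsJoint.symDrift_nonneg (h : IsJoint Ψ φ) (hφ : JointCond d φ) (v z : Vec d) :
    0 ≤ symDrift Ψ v z := by
  have h1 := h.le_symDrift hφ v z
  have h2 : 0 ≤ (φ ‖v + z‖ + φ ‖v - z‖) *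
      (inner ℝ (v + z) (v - z) + ‖v + z‖ * ‖v - z‖) := by
    by_cases hA : v + z = 0
    · simp [hA]
    by_cases hB : v - z = 0
    · simp [hB]
    refine mul_nonneg (add_pos (hφ.pos _ (norm_pos_iff.mpr hA))
      (hφ.pos _ (norm_pos_iff.mpr hB))).le ?_
    linarith [neg_le_of_abs_le (abs_real_inner_le_norm (v + z) (v - z))]
  linarith

lemma exists_norm_eq_one_inner_eq_zero {d : ℕ} (hd : 2 ≤ d) (v : Vec d) :
    ∃ u : Vec d, ‖u‖ = 1 ∧ inner ℝ v u = 0 := by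
  have h1 := Submodule.finrank_add_finrank_orthogonal (ℝ ∙ v)
  have h2 : Module.finrank ℝ (ℝ ∙ v) ≤ 1 := by
    simpa using finrank_span_le_card (R := ℝ) ({v} : Set (Vec d))
  rw [finrank_euclideanSpace_fin] at h1
  have : Nontrivial ↥(ℝ ∙ v)ᗮ := Module.nontrivial_of_finrank_pos (R := ℝ) (by omega)
  obtain ⟨u, hu⟩ := exists_norm_eq (↥(ℝ ∙ v)ᗮ) zero_le_one
  exact ⟨u, hu, Submodule.mem_orthogonal_singleton_iff_inner_right.mp u.2⟩

/-- The inner product is `‖v‖² - ‖z‖²`, so it suffices that `‖v + z‖ * ‖v - z‖ ≥ ‖z‖²`. This holds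
because `z` is nearly orthogonal to `v`: `|⟨v, z⟩| ≤ ‖v‖ E / 8` while `‖z‖ ≥ 3E / 8`. For `z`
parallel to `v` and longer, the right-hand side would vanish, hence the need for an orthogonal
direction. -/
lemma le_inner_add_norm_mul_norm {d : ℕ} {E : ℝ} (hE : 0 < E) {u v z : Vec d} (hu : ‖u‖ = 1)
    (hvu : inner ℝ v u = 0) (hz : z ∈ Metric.ball ((E / 2) • u) (E / 8)) :
    0 < ‖v + z‖ * ‖v - z‖ ∧
      ‖v‖ ^ 2 ≤ inner ℝ (v + z) (v - z) + ‖v + z‖ * ‖v - z‖ := by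
  rw [Metric.mem_ball, dist_eq_norm] at hz
  have hun : ‖(E / 2) • u‖ = E / 2 := by
    rw [norm_smul, hu, mul_one, Real.norm_of_nonneg (by positivity)]
  have hzn : 3 * E / 8 ≤ ‖z‖ := by
    have := norm_sub_norm_le ((E / 2) • u) z
    rw [norm_sub_rev, hun] at this
    linarith
  have hvz : |inner ℝ v z| ≤ ‖v‖ * (E / 8) := by
    have e : inner ℝ v z = inner ℝ v (z - (E / 2) • u) := by
      rw [inner_sub_right, inner_smul_right, hvu, mul_zero, sub_zero]
    rw [e]
    exact (abs_real_inner_le_norm _ _).trans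
      (mul_le_mul_of_nonneg_left hz.le (norm_nonneg _))
  have hs : (inner ℝ v z) ^ 2 ≤ ‖v‖ ^ 2 * (E ^ 2 / 64) := by
    rw [← sq_abs]
    refine (pow_le_pow_left₀ (abs_nonneg _) hvz 2).trans (le_of_eq (by ring))
  have hb : 9 * E ^ 2 / 64 ≤ ‖z‖ ^ 2 := by nlinarith
  have e1 : inner ℝ (v + z) (v - z) = ‖v‖ ^ 2 - ‖z‖ ^ 2 := by
    rw [inner_add_left, inner_sub_right, inner_sub_right, real_inner_self_eq_norm_sq,
      real_inner_self_eq_norm_sq, real_inner_comm]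
    ring
  have e2 : (‖v + z‖ * ‖v - z‖) ^ 2 =
      (‖v‖ ^ 2 + ‖z‖ ^ 2) ^ 2 - 4 * (inner ℝ v z) ^ 2 := by
    rw [mul_pow, norm_add_sq_real, norm_sub_sq_real]; ring
  have h1 : ‖z‖ ^ 2 ≤ ‖v + z‖ * ‖v - z‖ := by
    refine le_of_sq_le_sq ?_ (by positivity)
    rw [e2]
    nlinarith [mul_le_mul_of_nonneg_left hb (sq_nonneg ‖v‖), sq_nonneg (‖v‖ ^ 2)]
  have h2 : 0 < ‖z‖ ^ 2 := pow_pos (by linarith) 2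
  exact ⟨h2.trans_le h1, by rw [e1]; linarith⟩

/-- For `‖v‖ ≤ 1` this is the monotonicity of `φ`; for `‖v‖ ≥ 1` it is that of `r φ(r)`, with `‖v‖ +
E ≤ (1 + E) ‖v‖`. -/
lemma JointCond.mul_minNormSq_le (hφ : JointCond d φ) {E : ℝ} (hE : 0 < E) (v : Vec d) :
    φ (1 + E) * minNormSq v ≤ φ (‖v‖ + E) * ‖v‖ ^ 2 := by
  have hpos := hφ.pos (1 + E) (by linarith)
  have hn := norm_nonneg v
  rcases le_total ‖v‖ 1 with h | h
  · have h1 := hφ.antitone (a := ‖v‖ + E) (b := 1 + E) (Set.mem_Ioi.mpr (by linarith))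
      (Set.mem_Ioi.mpr (by linarith)) (by linarith)
    exact mul_le_mul h1 (min_le_right _ _) (minNormSq_nonneg v) (hpos.le.trans h1)
  · have h1 := hφ.mul_monotone (a := 1 + E) (b := ‖v‖ + E) (Set.mem_Ioi.mpr (by linarith))
      (Set.mem_Ioi.mpr (by linarith)) (by linarith)
    simp only at h1
    have h2 := hφ.pos (‖v‖ + E) (by linarith)
    have h3 : φ (1 + E) ≤ φ (‖v‖ + E) * ‖v‖ := by
      have h4 : (1 + E) * φ (1 + E) ≤ (1 + E) * (φ (‖v‖ + E) * ‖v‖) := by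
        nlinarith [mul_nonneg h2.le (mul_nonneg hE.le (sub_nonneg.mpr h))]
      exact le_of_mul_le_mul_left h4 (by linarith)
    calc φ (1 + E) * minNormSq v ≤ φ (1 + E) * ‖v‖ :=
          mul_le_mul_of_nonneg_left (min_le_left _ _) hpos.le
      _ ≤ φ (‖v‖ + E) * ‖v‖ * ‖v‖ := mul_le_mul_of_nonneg_right h3 hn
      _ = φ (‖v‖ + E) * ‖v‖ ^ 2 := by ring

theorem IsJoint.exists_drift {κ : Kernel (Vec d) (Vec d)} [IsMarkovKernel κ]
    [∀ y, (κ y).IsNegInvariant] (hd : 2 ≤ d) (h : IsJoint Ψ φ) (hφ : JointCond d φ)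
    (hκ : UniformlyPositive κ) :
    ∃ β > 0, ∀ y v, β * minNormSq v ≤ ∫ z, inner ℝ (Ψ (v + z)) v ∂κ y := by
  obtain ⟨C, hC0, hC⟩ := hφ.bounded
  refine hκ.exists_drift (C := C) (h.measurable hφ) (fun x => by rw [h x]; exact hC x)
    (h.symDrift_nonneg hφ) fun E hE => ⟨E / 8, by positivity, φ (1 + E),
      hφ.pos _ (by linarith), fun v _ => ?_⟩
  obtain ⟨u, hu, hvu⟩ := exists_norm_eq_one_inner_eq_zero hd v
  have hun : ‖(E / 2) • u‖ = E / 2 := by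
    rw [norm_smul, hu, mul_one, Real.norm_of_nonneg (by positivity)]
  have hsub : Metric.ball ((E / 2) • u) (E / 8) ⊆ Metric.ball (0 : Vec d) E :=
    Metric.ball_subset_ball' (by rw [dist_zero_right, hun]; linarith)
  refine ⟨(E / 2) • u, hsub, fun z hz => (hφ.mul_minNormSq_le hE v).trans ?_⟩
  obtain ⟨hpq, hge⟩ := le_inner_add_norm_mul_norm hE hu hvu hz
  have hz' : ‖z‖ < E := by simpa using hsub hz
  have hp : 0 < ‖v + z‖ := (norm_nonneg _).lt_of_ne' (left_ne_zero_of_mul hpq.ne')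
  have hq : 0 < ‖v - z‖ := (norm_nonneg _).lt_of_ne' (right_ne_zero_of_mul hpq.ne')
  have hvE : 0 < ‖v‖ + E := by positivity
  have h1 := hφ.antitone (Set.mem_Ioi.mpr hp) (Set.mem_Ioi.mpr hvE)
    ((norm_add_le v z).trans (by linarith))
  have h2 := hφ.antitone (Set.mem_Ioi.mpr hq) (Set.mem_Ioi.mpr hvE)
    ((norm_sub_le v z).trans (by linarith))
  have h3 := h.le_symDrift hφ v z
  have h4 := mul_le_mul (add_le_add h1 h2) hge (by positivity)
    (add_pos (hφ.pos _ hp) (hφ.pos _ hq)).le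
  linarith

end Joint

/-! ### Component-wise nonlinearities -/

/-- A bounded, odd, monotone scalar map that is positive on the positive axis. -/
structure IsSignLike (ψ : ℝ → ℝ) : Prop where
  monotone : Monotone ψ
  odd : ∀ x, ψ (-x) = -ψ x
  pos : ∀ r, 0 < r → 0 < ψ r
  bounded : ∃ C > 0, ∀ x, |ψ x| ≤ C

/-- If `ψ r ≤ 0` for some `r > 0`, oddness and monotonicity force `ψ = 0` on `(-r, r)`, which
contradicts both nondegeneracy alternatives. -/
lemma ComponentCond.isSignLike {ψ : ℝ → ℝ} (h : ComponentCond ψ) : IsSignLike ψ := by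
  refine ⟨h.monotone, h.odd, fun r hr => ?_, h.bounded⟩
  by_contra! hcon
  have hr' : 0 ≤ ψ (-r) := by rw [h.odd]; linarith
  have hz : ∀ s ∈ Set.Ioo (-r) r, ψ s = 0 := fun s hs =>
    le_antisymm ((h.monotone hs.2.le).trans hcon) (hr'.trans (h.monotone hs.1.le))
  rcases h.nondegenerate with hd | ⟨c, hc, hs⟩
  · refine hd (ContinuousAt.congr (f := fun _ => (0 : ℝ)) continuousAt_const ?_)
    filter_upwards [Ioo_mem_nhds (neg_lt_zero.mpr hr) hr] with s hs
    exact (hz s hs).symm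
  · have hm : 0 < min c r := lt_min hc hr
    have h1 := hs (a := 0) (b := min c r / 2) ⟨by linarith, hc⟩
      ⟨by linarith, by linarith [min_le_left c r]⟩ (by linarith)
    rw [hz 0 ⟨by linarith, hr⟩,
      hz (min c r / 2) ⟨by linarith, by linarith [min_le_right c r]⟩] at h1
    exact lt_irrefl _ h1

/-- In dimension one, a joint nonlinearity is component-wise. -/
lemma IsJoint.isComponentwise {Ψ : Vec 1 → Vec 1} {φ : ℝ → ℝ} (h : IsJoint Ψ φ) :
    IsComponentwise Ψ (fun r => φ |r| * r) := by
  intro x i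
  have : ‖x‖ = |x i| := by
    rw [EuclideanSpace.norm_eq, Fin.sum_univ_one, Subsingleton.elim i 0, Real.sqrt_sq (norm_nonneg _),
      Real.norm_eq_abs]
  rw [h x, this]
  rfl

/-- In dimension one there is no direction orthogonal to `v`; joint maps are treated there as
component-wise ones. -/
lemma JointCond.isSignLike {φ : ℝ → ℝ} (h : JointCond 1 φ) :
    IsSignLike (fun r => φ |r| * r) := by
  have hpos : ∀ r, 0 < r → 0 < φ |r| * r := fun r hr => by
    rw [abs_of_pos hr]; exact mul_pos (h.pos r hr) hr
  have hodd : ∀ r, φ |-r| * (-r) = -(φ |r| * r) := fun r => by rw [abs_neg]; ring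
  have hmono : ∀ r s, 0 < r → r ≤ s → φ |r| * r ≤ φ |s| * s := fun r s hr hrs => by
    have := h.mul_monotone hr (hr.trans_le hrs) hrs
    rw [abs_of_pos hr, abs_of_pos (hr.trans_le hrs)]
    linarith
  refine ⟨fun r s hrs => ?_, hodd, hpos, ?_⟩
  · rcases lt_trichotomy r 0 with hr | rfl | hr
    · rcases lt_trichotomy s 0 with hs | rfl | hs
      · have := hmono (-s) (-r) (by linarith) (by linarith)
        rw [hodd, hodd] at this
        exact neg_le_neg_iff.mp this
      · have := hpos (-r) (by linarith)
        rw [hodd] at this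
        simp only [mul_zero]; linarith
      · have := hpos (-r) (by linarith)
        rw [hodd] at this
        have := hpos s hs
        linarith
    · rcases hrs.eq_or_lt with rfl | hs
      · exact le_rfl
      · simpa using (hpos s hs).le
    · exact hmono r s hr hrs
  · obtain ⟨C, hC0, hC⟩ := h.bounded
    refine ⟨C, hC0, fun r => ?_⟩
    have hn : ‖(WithLp.toLp 2 fun _ : Fin 1 => r : Vec 1)‖ = |r| := by
      rw [EuclideanSpace.norm_eq, Fin.sum_univ_one, Real.sqrt_sq (norm_nonneg _),
        Real.norm_eq_abs]
    have := hC (WithLp.toLp 2 fun _ : Fin 1 => r)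
    rw [norm_smul, hn, Real.norm_eq_abs] at this
    rwa [abs_mul]

lemma exists_norm_le_mul_abs {d : ℕ} (hd : 0 < d) (v : Vec d) : ∃ i, ‖v‖ ≤ d * |v i| := by
  have : Nonempty (Fin d) := ⟨⟨0, hd⟩⟩
  obtain ⟨i, hi⟩ := Finite.exists_max fun j => |v j|
  refine ⟨i, le_of_sq_le_sq ?_ (by positivity)⟩
  rw [EuclideanSpace.norm_sq_eq]
  have h1 : ∑ j, ‖v j‖ ^ 2 ≤ ∑ _j : Fin d, |v i| ^ 2 :=
    Finset.sum_le_sum fun j _ => pow_le_pow_left₀ (norm_nonneg _) (hi j) 2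
  refine h1.trans ?_
  have hd1 : (1 : ℝ) ≤ d := by exact_mod_cast hd
  rw [Finset.sum_const, Finset.card_univ, Fintype.card_fin, nsmul_eq_mul, mul_pow]
  refine mul_le_mul_of_nonneg_right ?_ (by positivity)
  nlinarith

lemma mul_minNormSq_le_abs_mul_min {d : ℕ} (hd : 0 < d) {v : Vec d} {w ρ : ℝ} (hρ : 0 < ρ)
    (hw : ‖v‖ ≤ d * |w|) : min 1 ρ / d ^ 2 * minNormSq v ≤ |w| * min |w| ρ := by
  have hd1 : (1 : ℝ) ≤ d := by exact_mod_cast hd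
  set b := min 1 ρ with hb
  have hb0 : 0 < b := lt_min one_pos hρ
  have hb1 : b ≤ 1 := min_le_left _ _
  have hbρ : b ≤ ρ := min_le_right _ _
  have hn := norm_nonneg v
  rw [div_mul_eq_mul_div, div_le_iff₀ (by positivity)]
  rcases min_cases |w| ρ with ⟨e, _⟩ | ⟨e, _⟩ <;> rw [e]
  · calc b * minNormSq v ≤ 1 * ‖v‖ ^ 2 :=
          mul_le_mul hb1 (min_le_right _ _) (minNormSq_nonneg v) zero_le_one
      _ ≤ (d * |w|) ^ 2 := by rw [one_mul]; exact pow_le_pow_left₀ hn hw 2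
      _ = |w| * |w| * d ^ 2 := by ring
  · calc b * minNormSq v ≤ ρ * ‖v‖ :=
          mul_le_mul hbρ (min_le_left _ _) (minNormSq_nonneg v) hρ.le
      _ ≤ ρ * (d * |w|) := mul_le_mul_of_nonneg_left hw hρ.le
      _ ≤ ρ * (d * |w|) * d := le_mul_of_one_le_right (by positivity) hd1
      _ = |w| * ρ * d ^ 2 := by ring

section Componentwise

variable {d : ℕ} {Ψ : Vec d → Vec d} {ψ : ℝ → ℝ}

lemma IsComponentwise.measurable (h : IsComponentwise Ψ ψ) (hψ : IsSignLike ψ) :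
    Measurable Ψ := by
  have h1 : Measurable fun x => (Ψ x).ofLp := by
    refine measurable_pi_lambda _ fun i => ?_
    simp only [h _ i]
    exact hψ.monotone.measurable.comp
      ((measurable_pi_apply i).comp (PiLp.volume_preserving_ofLp (Fin d)).measurable)
  exact (PiLp.volume_preserving_toLp (Fin d)).measurable.comp h1

lemma IsComponentwise.exists_bound (h : IsComponentwise Ψ ψ) (hψ : IsSignLike ψ) :
    ∃ C > 0, ∀ x, ‖Ψ x‖ ≤ C := by
  obtain ⟨C, hC0, hC⟩ := hψ.bounded
  refine ⟨√(d * C ^ 2) + 1, by positivity, fun x => ?_⟩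
  rw [EuclideanSpace.norm_eq]
  refine (Real.sqrt_le_sqrt ?_).trans (le_add_of_nonneg_right zero_le_one)
  calc ∑ i, ‖Ψ x i‖ ^ 2 ≤ ∑ _i : Fin d, C ^ 2 := Finset.sum_le_sum fun i _ => by
        rw [h x i]; exact pow_le_pow_left₀ (norm_nonneg _) (hC _) 2
    _ = d * C ^ 2 := by simp

/-- The symmetrized drift of a scalar odd map. -/
lemma mul_add_eq_abs_mul_sub (hodd : ∀ x, ψ (-x) = -ψ x) (w s : ℝ) :
    w * (ψ (w + s) + ψ (w - s)) = |w| * (ψ (s + |w|) - ψ (s - |w|)) := by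
  rcases le_total 0 w with hw | hw
  · rw [abs_of_nonneg hw, ← neg_sub s w, hodd, add_comm w s]; ring
  · rw [abs_of_nonpos hw, sub_neg_eq_add, add_comm s w, ← sub_eq_add_neg, ← neg_sub w s, hodd]
    ring

lemma IsComponentwise.symDrift_eq (h : IsComponentwise Ψ ψ) (hψ : IsSignLike ψ) (v z : Vec d) :
    symDrift Ψ v z = ∑ i, |v i| * (ψ (z i + |v i|) - ψ (z i - |v i|)) := by
  simp only [symDrift, PiLp.inner_apply, h _ _, ← Finset.sum_add_distrib]
  refine Finset.sum_congr rfl fun i _ => ?_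
  rw [← mul_add_eq_abs_mul_sub hψ.odd]
  simp only [PiLp.add_apply, PiLp.sub_apply, RCLike.inner_apply, conj_trivial]
  ring

lemma IsSignLike.term_nonneg (hψ : IsSignLike ψ) (w s : ℝ) :
    0 ≤ |w| * (ψ (s + |w|) - ψ (s - |w|)) :=
  mul_nonneg (abs_nonneg w) (sub_nonneg.mpr (hψ.monotone (by linarith [abs_nonneg w])))

/-- Oddness turns each coordinate's contribution into an increment of the monotone `ψ`, so all are
nonnegative and a single one may be kept. -/
lemma IsComponentwise.term_le_symDrift (h : IsComponentwise Ψ ψ) (hψ : IsSignLike ψ) (v z : Vec d)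
    (i : Fin d) : |v i| * (ψ (z i + |v i|) - ψ (z i - |v i|)) ≤ symDrift Ψ v z := by
  rw [h.symDrift_eq hψ]
  exact Finset.single_le_sum
    (f := fun i => |v i| * (ψ (z i + |v i|) - ψ (z i - |v i|)))
    (fun j _ => hψ.term_nonneg (v j) (z j)) (Finset.mem_univ i)

lemma IsComponentwise.symDrift_nonneg (h : IsComponentwise Ψ ψ) (hψ : IsSignLike ψ)
    (v z : Vec d) : 0 ≤ symDrift Ψ v z := by
  rw [h.symDrift_eq hψ]
  exact Finset.sum_nonneg fun j _ => hψ.term_nonneg (v j) (z j)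

/-! #### Continuously differentiable maps -/

/-- The derivative may vanish at zero, but `ψ 0 = 0 < ψ E` makes it positive at some `ζ` in between,
and at least half as large nearby. With `ρ` half the radius, the segment from `s` to `s + min w ρ`
stays in that neighbourhood. -/
lemma IsSignLike.exists_increment (hψ : IsSignLike ψ) (hC : ContDiff ℝ 1 ψ) {E : ℝ} (hE : 0 < E) :
    ∃ ζ ∈ Set.Ioo 0 E, ∃ ρ > 0, ∃ m > 0, ∀ s, |s - ζ| < ρ → ∀ w, 0 ≤ w →
      m * min w ρ ≤ ψ (s + w) - ψ (s - w) := by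
  have hdiff : Differentiable ℝ ψ := hC.differentiable one_ne_zero
  obtain ⟨ζ, hζ, hslope⟩ := exists_deriv_eq_slope ψ hE hC.continuous.continuousOn
    hdiff.differentiableOn
  have h0 : ψ 0 = 0 := by
    have := hψ.odd 0
    rw [neg_zero] at this
    linarith
  have hpos : 0 < deriv ψ ζ := by
    rw [hslope, h0, sub_zero, sub_zero]; exact div_pos (hψ.pos E hE) hE
  have hev := (hC.continuous_deriv le_rfl).continuousAt.eventually
    (lt_mem_nhds (half_lt_self hpos))
  obtain ⟨r, hr, hball⟩ := Metric.eventually_nhds_iff.mp hev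
  refine ⟨ζ, hζ, r / 2, by positivity, deriv ψ ζ / 2, by positivity, fun s hs w hw => ?_⟩
  set w' := min w (r / 2) with hw'
  have hw'0 : 0 ≤ w' := le_min hw (by positivity)
  have hw'r : w' ≤ r / 2 := min_le_right _ _
  rw [abs_lt] at hs
  have h1 := Convex.mul_sub_le_image_sub_of_le_deriv (convex_Icc s (s + w'))
    (hC.continuous.continuousOn) (f := ψ) (hdiff.differentiableOn) (C := deriv ψ ζ / 2)
    (fun y hy => by
      rw [interior_Icc] at hy
      refine (hball ?_).le
      rw [Real.dist_eq, abs_lt]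
      constructor <;> linarith [hy.1, hy.2]) s (Set.left_mem_Icc.mpr (by linarith)) (s + w')
    (Set.right_mem_Icc.mpr (by linarith)) (by linarith)
  rw [add_sub_cancel_left] at h1
  have h2 : ψ (s + w') ≤ ψ (s + w) := hψ.monotone (by linarith [min_le_left w (r / 2)])
  have h3 : ψ (s - w) ≤ ψ s := hψ.monotone (by linarith)
  linarith

/-- The ball is centred at `ζ` times the basis vector of the largest coordinate of `v`. Its centre
depends on `v`, so the noise bound has to be uniform over centres. -/
theorem IsComponentwise.exists_drift_of_contDiff {κ : Kernel (Vec d) (Vec d)} [IsMarkovKernel κ]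
    [∀ y, (κ y).IsNegInvariant] (hd : 0 < d) (h : IsComponentwise Ψ ψ) (hψ : IsSignLike ψ)
    (hC : ContDiff ℝ 1 ψ) (hκ : UniformlyPositive κ) :
    ∃ β > 0, ∀ y v, β * minNormSq v ≤ ∫ z, inner ℝ (Ψ (v + z)) v ∂κ y := by
  obtain ⟨C, -, hbd⟩ := h.exists_bound hψ
  refine hκ.exists_drift (h.measurable hψ) hbd (h.symDrift_nonneg hψ) fun E hE => ?_
  obtain ⟨ζ, hζ, ρ, hρ, m, hm, hinc⟩ := hψ.exists_increment hC hE
  refine ⟨min ρ (E - ζ), lt_min hρ (by linarith [hζ.2]), m * (min 1 ρ / d ^ 2), by positivity,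
    fun v _ => ?_⟩
  obtain ⟨i, hi⟩ := exists_norm_le_mul_abs hd v
  have hn : ‖EuclideanSpace.single i ζ‖ = ζ := by
    rw [PiLp.norm_single, Real.norm_of_nonneg hζ.1.le]
  refine ⟨EuclideanSpace.single i ζ, Metric.ball_subset_ball' ?_, fun z hz => ?_⟩
  · rw [dist_zero_right, hn]; linarith [min_le_right ρ (E - ζ)]
  · have hzi : |z i - ζ| < ρ := by
      rw [Metric.mem_ball, dist_eq_norm] at hz
      have h1 := PiLp.norm_apply_le (z - EuclideanSpace.single i ζ) i
      simp only [PiLp.sub_apply, PiLp.single_apply, if_true, Real.norm_eq_abs] at h1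
      exact h1.trans_lt (hz.trans_le (min_le_left _ _))
    refine le_trans ?_ (h.term_le_symDrift hψ v z i)
    calc m * (min 1 ρ / d ^ 2) * minNormSq v = m * (min 1 ρ / d ^ 2 * minNormSq v) := by ring
      _ ≤ m * (|v i| * min |v i| ρ) :=
        mul_le_mul_of_nonneg_left (mul_minNormSq_le_abs_mul_min hd hρ hi) hm.le
      _ = |v i| * (m * min |v i| ρ) := by ring
      _ ≤ _ := mul_le_mul_of_nonneg_left (hinc _ hzi _ (abs_nonneg _)) (abs_nonneg _)

/-! #### Noise with a density bounded from below near the origin -/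

/-- For a jump such as the sign function, the increment vanishes unless `|s| ≤ w`, so no fixed set
of `s` works and the increments are averaged instead. After `w` is cut to `w' ≤ e/2`, the integral
telescopes to the ends and equals twice that of `ψ` over `[e - w', e + w']`, where `ψ ≥ ψ(e/2)`. -/
lemma IsSignLike.integral_sub_ge (hψ : IsSignLike ψ) {e w : ℝ} (he : 0 < e) (hw : 0 ≤ w) :
    4 * ψ (e / 2) * min w (e / 2) ≤ ∫ s in -e..e, (ψ (s + w) - ψ (s - w)) := by
  have hint : ∀ a b, IntervalIntegrable ψ volume a b := fun a b => hψ.monotone.intervalIntegrable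
  have hintp : ∀ w a b, IntervalIntegrable (fun s => ψ (s + w)) volume a b := fun w a b =>
    (hψ.monotone.comp (fun _ _ h => by simpa using h : Monotone fun s : ℝ => s + w)).intervalIntegrable
  have hintm : ∀ w a b, IntervalIntegrable (fun s => ψ (s - w)) volume a b := fun w a b => by
    simpa only [sub_eq_add_neg] using hintp (-w) a b
  set w' := min w (e / 2) with hw'
  have hw'0 : 0 ≤ w' := le_min hw (by positivity)
  have hw'e : w' ≤ e / 2 := min_le_right _ _
  have hw'w : w' ≤ w := min_le_left _ _
  have h1 : ∫ s in -e..e, (ψ (s + w') - ψ (s - w')) ≤ ∫ s in -e..e, (ψ (s + w) - ψ (s - w)) :=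
    intervalIntegral.integral_mono_on (by linarith) ((hintp _ _ _).sub (hintm _ _ _))
      ((hintp _ _ _).sub (hintm _ _ _)) fun s _ =>
        sub_le_sub (hψ.monotone (by linarith)) (hψ.monotone (by linarith))
  refine le_trans ?_ h1
  rw [intervalIntegral.integral_sub (hintp _ _ _) (hintm _ _ _),
    intervalIntegral.integral_comp_add_right, intervalIntegral.integral_comp_sub_right,
    intervalIntegral.integral_interval_sub_interval_comm' (hint _ _) (hint _ _) (hint _ _)]
  have h2 : ∫ s in (-e - w')..(-e + w'), ψ s = -∫ s in (e - w')..(e + w'), ψ s := by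
    have := intervalIntegral.integral_comp_neg (a := e - w') (b := e + w') ψ
    simp only [hψ.odd, intervalIntegral.integral_neg] at this
    rw [this, neg_add', neg_sub', sub_neg_eq_add]
  have h3 : ∫ _s in (e - w')..(e + w'), ψ (e / 2) ≤ ∫ s in (e - w')..(e + w'), ψ s :=
    intervalIntegral.integral_mono_on (by linarith) (by simp) (hint _ _) fun s hs =>
      hψ.monotone (by linarith [hs.1])
  rw [intervalIntegral.integral_const, smul_eq_mul] at h3
  rw [h2]
  linarith

/-- `ν` has a part with a positive constant density near the origin. -/
def HasDensityNearZero {d : ℕ} (ν : Measure (Vec d)) : Prop :=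
  ∃ E > 0, ∃ c > 0, ∀ S, MeasurableSet S → S ⊆ Metric.ball (0 : Vec d) E →
    ENNReal.ofReal c * volume S ≤ ν S

lemma HasDensityNearZero.exists_coordinate {ν : Measure (Vec d)} (hν : HasDensityNearZero ν) :
    ∃ e > 0, ∃ c > 0, ∀ i : Fin d,
      ENNReal.ofReal c • volume.restrict (Set.Ioc (-e) e) ≤ ν.map (fun z => z i) := by
  obtain ⟨E, hE, c, hc, h⟩ := hν
  -- The cube of half-width `e` lies in the ball of radius `E`; integrating out the other
  -- coordinates gives the factor `(2e)^(d-1)`.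
  set e := E / (2 * (d + 1)) with he
  have he0 : 0 < e := by positivity
  refine ⟨e, he0, c * (2 * e) ^ (d - 1), by positivity, fun i => ?_⟩
  have hcoord : ∀ j : Fin d, Measurable fun z : Vec d => z j := fun j =>
    (measurable_pi_apply j).comp (PiLp.volume_preserving_ofLp (Fin d)).measurable
  refine Measure.le_iff.mpr fun T hT => ?_
  rw [Measure.smul_apply, smul_eq_mul, Measure.restrict_apply hT, Measure.map_apply (hcoord i) hT]
  set U : Fin d → Set ℝ := Function.update (fun _ => Set.Ioc (-e) e) i (T ∩ Set.Ioc (-e) e) with hU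
  have hUm : ∀ j, MeasurableSet (U j) := fun j => by
    by_cases hj : j = i
    · subst hj; simpa [hU] using hT.inter measurableSet_Ioc
    · simp [hU, hj]
  have hUs : ∀ j, U j ⊆ Set.Ioc (-e) e := fun j => by
    by_cases hj : j = i
    · subst hj; simp [hU]
    · simp [hU, hj]
  set S : Set (Vec d) := WithLp.ofLp ⁻¹' Set.univ.pi U with hS
  have hSm : MeasurableSet S :=
    (PiLp.volume_preserving_ofLp (Fin d)).measurable (MeasurableSet.univ_pi hUm)
  have hSv : volume S = volume (T ∩ Set.Ioc (-e) e) * ENNReal.ofReal ((2 * e) ^ (d - 1)) := by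
    rw [hS, (PiLp.volume_preserving_ofLp (Fin d)).measure_preimage
      (MeasurableSet.univ_pi hUm).nullMeasurableSet, volume_pi_pi,
      ← Finset.mul_prod_erase Finset.univ _ (Finset.mem_univ i)]
    congr 1
    · simp [hU]
    · rw [Finset.prod_congr rfl (g := fun _ => ENNReal.ofReal (2 * e))]
      · simp [ENNReal.ofReal_pow (show 0 ≤ 2 * e by positivity)]
      · intro j hj
        rw [hU, Function.update_of_ne (Finset.ne_of_mem_erase hj), Real.volume_Ioc]
        congr 1; ring
  have hSb : S ⊆ Metric.ball 0 E := by
    intro z hz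
    rw [mem_ball_zero_iff]
    rcases Nat.eq_zero_or_pos d with rfl | hd
    · exact i.elim0
    obtain ⟨j, hj⟩ := exists_norm_le_mul_abs hd z
    have h1 := hUs j (hz j trivial)
    have h2 : |z j| ≤ e := abs_le.mpr ⟨h1.1.le, h1.2⟩
    calc ‖z‖ ≤ d * |z j| := hj
      _ ≤ d * e := mul_le_mul_of_nonneg_left h2 (by positivity)
      _ < E := by rw [he, ← mul_div_assoc, div_lt_iff₀ (by positivity)]; nlinarith
  have hSi : S ⊆ (fun z : Vec d => z i) ⁻¹' T := fun z hz => by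
    have := hz i trivial
    simp only [hU, Function.update_self] at this
    exact this.1
  calc ENNReal.ofReal (c * (2 * e) ^ (d - 1)) * volume (T ∩ Set.Ioc (-e) e)
      = ENNReal.ofReal c * volume S := by
        rw [hSv, ENNReal.ofReal_mul hc.le]; ring
    _ ≤ ν S := h S hSm hSb
    _ ≤ _ := measure_mono hSi

theorem IsComponentwise.exists_drift_of_density {ν : Measure (Vec d)} [IsProbabilityMeasure ν]
    [ν.IsNegInvariant] (hd : 0 < d) (h : IsComponentwise Ψ ψ) (hψ : IsSignLike ψ)
    (hν : HasDensityNearZero ν) :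
    ∃ β > 0, ∀ v, β * minNormSq v ≤ ∫ z, inner ℝ (Ψ (v + z)) v ∂ν := by
  obtain ⟨C, -, hbd⟩ := h.exists_bound hψ
  obtain ⟨C₁, hC₁, hbd₁⟩ := hψ.bounded
  obtain ⟨e, he, c, hc, hcoord⟩ := hν.exists_coordinate
  have hψe := hψ.pos (e / 2) (by positivity)
  refine ⟨2 * c * ψ (e / 2) * (min 1 (e / 2) / d ^ 2), by positivity, fun v => ?_⟩
  obtain ⟨i, hi⟩ := exists_norm_le_mul_abs hd v
  have hmeas : Measurable fun z : Vec d => z i :=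
    (measurable_pi_apply i).comp (PiLp.volume_preserving_ofLp (Fin d)).measurable
  set g : ℝ → ℝ := fun s => |v i| * (ψ (s + |v i|) - ψ (s - |v i|)) with hg
  have hgm : Measurable g := ((hψ.monotone.measurable.comp (measurable_add_const _)).sub
    (hψ.monotone.measurable.comp (measurable_sub_const _))).const_mul _
  have : IsProbabilityMeasure (ν.map fun z => z i) := Measure.isProbabilityMeasure_map hmeas.aemeasurable
  have hgi : Integrable g (ν.map fun z => z i) := by
    refine Integrable.of_bound hgm.aestronglyMeasurable (|v i| * (C₁ + C₁)) (ae_of_all _ fun s => ?_)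
    rw [hg, Real.norm_eq_abs, abs_mul, abs_abs]
    exact mul_le_mul_of_nonneg_left ((abs_sub _ _).trans (add_le_add (hbd₁ _) (hbd₁ _)))
      (abs_nonneg _)
  have h1 : ∫ z, g (z i) ∂ν ≤ ∫ z, symDrift Ψ v z ∂ν :=
    integral_mono (hgi.comp_measurable hmeas) (integrable_symDrift (h.measurable hψ) hbd v)
      fun z => h.term_le_symDrift hψ v z i
  have h2 : ∫ s, g s ∂(ENNReal.ofReal c • volume.restrict (Set.Ioc (-e) e)) ≤
      ∫ s, g s ∂(ν.map fun z => z i) :=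
    integral_mono_measure (hcoord i) (ae_of_all _ fun s => hψ.term_nonneg _ _) hgi
  rw [integral_map hmeas.aemeasurable hgm.aestronglyMeasurable, integral_smul_measure,
    ENNReal.toReal_ofReal hc.le, ← intervalIntegral.integral_of_le (by linarith), hg,
    intervalIntegral.integral_const_mul, smul_eq_mul] at h2
  rw [integral_symDrift (h.measurable hψ) hbd v] at h1
  have h3 := mul_le_mul_of_nonneg_left (mul_le_mul_of_nonneg_left
    (hψ.integral_sub_ge he (abs_nonneg (v i))) (abs_nonneg (v i))) hc.le
  have h4 := mul_le_mul_of_nonneg_left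
    (mul_minNormSq_le_abs_mul_min hd (show 0 < e / 2 by positivity) hi)
    (show 0 ≤ 2 * c * ψ (e / 2) by positivity)
  linarith

end Componentwise

/-! ### State-dependent symmetric noise -/

/-- The Markov kernel with the densities `P x`. -/
noncomputable def densityKernel {d : ℕ} (P : Vec d → Vec d → ℝ) : Kernel (Vec d) (Vec d) :=
  (Kernel.const (Vec d) volume).withDensity fun x z => ENNReal.ofReal (P x z)

namespace IsSymmetricNoise

variable {d : ℕ} {P : Vec d → Vec d → ℝ}

lemma densityKernel_apply (hP : IsSymmetricNoise P) (y : Vec d) :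
    densityKernel P y = volume.withDensity fun z => ENNReal.ofReal (P y z) := by
  rw [densityKernel, Kernel.withDensity_apply _ (by exact hP.measurable.ennreal_ofReal),
    Kernel.const_apply]

lemma isMarkovKernel (hP : IsSymmetricNoise P) : IsMarkovKernel (densityKernel P) :=
  ⟨fun y => ⟨by
    rw [hP.densityKernel_apply, withDensity_apply _ MeasurableSet.univ, Measure.restrict_univ]
    exact (hP.pdf y).lintegral_eq_one⟩⟩

lemma isNegInvariant (hP : IsSymmetricNoise P) (y : Vec d) :
    (densityKernel P y).IsNegInvariant := by
  refine ⟨Measure.ext fun S hS => ?_⟩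
  rw [Measure.neg, Measure.map_apply measurable_neg hS, hP.densityKernel_apply,
    withDensity_apply _ hS, withDensity_apply _ (measurable_neg hS),
    ← (Measure.measurePreserving_neg (volume : Measure (Vec d))).setLIntegral_comp_preimage hS
      (hP.pdf y).measurable.ennreal_ofReal]
  simp only [hP.symmetric]

/-- The infimum over states is positive at each point but may have no positive lower bound over the
ball. Its superlevel sets exhaust the ball, so one of them misses less than half the volume of an
`r`-ball, and every `r`-ball inside meets it substantially. -/
lemma uniformlyPositive (hP : IsSymmetricNoise P) : UniformlyPositive (densityKernel P) := by
  obtain ⟨E, hE, hpos⟩ := hP.positive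
  refine ⟨E, hE, fun r hr => ?_⟩
  set V := volume (Metric.ball (0 : Vec d) r) with hV
  have hV0 : 0 < V := Metric.measure_ball_pos _ _ hr
  have hVtop : V ≠ ⊤ := measure_ball_lt_top.ne
  set A : ℕ → Set (Vec d) := fun n => {z | z ∈ Metric.ball (0 : Vec d) E ∧
    1 / ((n : ℝ) + 1) ≤ ⨅ x, P x z} with hA
  have hAmono : Monotone A := fun m n hmn z hz =>
    ⟨hz.1, (one_div_le_one_div_of_le (by positivity) (by gcongr)).trans hz.2⟩
  have hAU : ⋃ n, A n = Metric.ball (0 : Vec d) E := by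
    refine subset_antisymm (Set.iUnion_subset fun n z hz => hz.1) fun z hz => ?_
    obtain ⟨n, hn⟩ := exists_nat_one_div_lt (hpos z (by simpa using (mem_ball_zero_iff.mp hz).le))
    exact Set.mem_iUnion.mpr ⟨n, hz, hn.le⟩
  have hsup : volume (Metric.ball (0 : Vec d) E) = ⨆ n, volume (A n) := by
    rw [← hAU]; exact hAmono.directed_le.measure_iUnion
  have hEtop : volume (Metric.ball (0 : Vec d) E) ≠ ⊤ := measure_ball_lt_top.ne
  obtain ⟨n, hn⟩ : ∃ n, volume (Metric.ball (0 : Vec d) E) < volume (A n) + V / 2 := by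
    by_contra! hcon
    have h1 : (⨆ n, volume (A n)) + V / 2 ≤ volume (Metric.ball (0 : Vec d) E) := by
      rw [ENNReal.iSup_add]; exact iSup_le hcon
    rw [← hsup] at h1
    have h2 := ENNReal.lt_add_right hEtop (ENNReal.half_pos hV0.ne').ne'
    exact absurd h1 (not_le.mpr h2)
  refine ⟨1 / ((n : ℝ) + 1) * (V / 2).toReal,
    mul_pos (by positivity) (ENNReal.toReal_pos (ENNReal.half_pos hV0.ne').ne'
      (ENNReal.div_ne_top hVtop (by simp))), fun y p hp => ?_⟩
  -- An infimum over all states need not be measurable; for the fixed state `y`, `D` is a measurable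
  -- set containing `A n`.
  set D : Set (Vec d) := {z | 1 / ((n : ℝ) + 1) ≤ P y z} with hD
  have hDm : MeasurableSet D := measurableSet_le measurable_const (hP.pdf y).measurable
  have hAD : A n ⊆ Metric.ball (0 : Vec d) E ∩ D := fun z hz =>
    ⟨hz.1, hz.2.trans (ciInf_le ⟨0, by rintro _ ⟨x, rfl⟩; exact (hP.pdf x).nonneg z⟩ y)⟩
  have hdiff : volume (Metric.ball (0 : Vec d) E \ D) ≤ V / 2 := by
    have h1 := measure_inter_add_sdiff (μ := volume) (Metric.ball (0 : Vec d) E) hDm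
    have h2 : volume (Metric.ball (0 : Vec d) E ∩ D) ≠ ⊤ :=
      ((measure_mono Set.inter_subset_left).trans_lt measure_ball_lt_top).ne
    rw [← h1] at hn
    exact ((ENNReal.add_lt_add_iff_left h2).mp
      (hn.trans_le (add_le_add_left (measure_mono hAD) _))).le
  have hball : volume (Metric.ball p r) = V := by
    rw [hV, Measure.addHaar_ball_center]
  have hinter : V / 2 ≤ volume (Metric.ball p r ∩ D) := by
    have h1 := measure_inter_add_sdiff (μ := volume) (Metric.ball p r) hDm
    have h2 : volume (Metric.ball p r \ D) ≤ V / 2 :=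
      (measure_mono (Set.sdiff_subset_sdiff_left hp)).trans hdiff
    rw [hball] at h1
    have h3 : V / 2 + V / 2 ≤ volume (Metric.ball p r ∩ D) + V / 2 := by
      rw [ENNReal.add_halves]; exact h1.ge.trans (add_le_add_right h2 _)
    exact (ENNReal.add_le_add_iff_right (ENNReal.div_ne_top hVtop (by simp))).mp h3
  have hge : ENNReal.ofReal (1 / ((n : ℝ) + 1)) * (V / 2) ≤ densityKernel P y (Metric.ball p r) := by
    rw [hP.densityKernel_apply, withDensity_apply _ measurableSet_ball]
    calc _ ≤ ENNReal.ofReal (1 / ((n : ℝ) + 1)) * volume (Metric.ball p r ∩ D) :=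
          mul_le_mul_right hinter _
      _ = ∫⁻ _z in Metric.ball p r ∩ D, ENNReal.ofReal (1 / ((n : ℝ) + 1)) := by
          rw [setLIntegral_const]
      _ ≤ ∫⁻ z in Metric.ball p r ∩ D, ENNReal.ofReal (P y z) :=
          setLIntegral_mono (hP.pdf y).measurable.ennreal_ofReal fun z hz =>
            ENNReal.ofReal_le_ofReal hz.2
      _ ≤ _ := lintegral_mono_set Set.inter_subset_left
  have := hP.isMarkovKernel
  have h := ENNReal.toReal_mono (measure_ne_top _ _) hge
  rwa [ENNReal.toReal_mul, ENNReal.toReal_ofReal (by positivity)] at h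

lemma hasStateKernel (hP : IsSymmetricNoise P) {Ω : Type*} [MeasurableSpace Ω] {μ : Measure Ω}
    [IsProbabilityMeasure μ] {x z : ℕ → Ω → Vec d} (hx : ∀ k, 1 ≤ k → Measurable (x k))
    (hz : ∀ k, 1 ≤ k → Measurable (z k)) (h : HasStateDensity μ x z P) :
    HasStateKernel μ x z (densityKernel P) := by
  intro t ht S B hS hB
  have := hP.isMarkovKernel
  have hle := past_le (t := t) hx
  have hzB : MeasurableSet (z t ⁻¹' B) := hz t ht hB
  have hreal : ∀ y, ∫ u in B, P y u = (densityKernel P y).real B := fun y => by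
    rw [integral_eq_lintegral_of_nonneg_ae (ae_of_all _ (hP.pdf y).nonneg)
      (hP.pdf y).measurable.aestronglyMeasurable, measureReal_def, hP.densityKernel_apply,
      withDensity_apply _ hB]
  have h1 : ∫ ω in S, (z t ⁻¹' B).indicator (fun _ => (1 : ℝ)) ω ∂μ =
      ∫ ω in S, (densityKernel P (x t ω)).real B ∂μ := by
    rw [← setIntegral_condExp hle ((integrable_const (1 : ℝ)).indicator hzB) hS]
    refine setIntegral_congr_ae (hle S hS) ?_
    filter_upwards [h t ht B hB] with ω hω _
    rw [hω, hreal]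
  have h2 : ∫ ω in S, (z t ⁻¹' B).indicator (fun _ => (1 : ℝ)) ω ∂μ =
      μ.real (S ∩ z t ⁻¹' B) := by
    rw [setIntegral_indicator hzB, setIntegral_const, smul_eq_mul, mul_one]
  have hm : Measurable fun ω => densityKernel P (x t ω) B :=
    (Kernel.measurable_coe _ hB).comp (hx t ht)
  have h3 : ∫ ω in S, (densityKernel P (x t ω)).real B ∂μ =
      (∫⁻ ω in S, densityKernel P (x t ω) B ∂μ).toReal :=
    integral_toReal hm.aemeasurable (ae_of_all _ fun ω => measure_lt_top _ _)
  have h4 : ∫⁻ ω in S, densityKernel P (x t ω) B ∂μ ≠ ⊤ := by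
    refine ((lintegral_mono (g := fun _ => 1) fun ω => prob_le_one).trans_lt ?_).ne
    simp [measure_lt_top]
  exact (ENNReal.toReal_eq_toReal_iff' (measure_ne_top _ _) h4).mp
    (by rw [← h3, ← h1, h2, measureReal_def])

end IsSymmetricNoise

/-! ### Differences of independent noise vectors -/

section Difference

variable {d : ℕ} {ρ : Measure (Vec d)}

/-- The law of the difference of two independent vectors with law `ρ`. -/
noncomputable def differenceLaw (ρ : Measure (Vec d)) : Measure (Vec d) :=
  (ρ.prod ρ).map fun p => p.1 - p.2

instance [IsProbabilityMeasure ρ] : IsProbabilityMeasure (differenceLaw ρ) :=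
  Measure.isProbabilityMeasure_map (measurable_fst.sub measurable_snd).aemeasurable

instance [IsProbabilityMeasure ρ] : (differenceLaw ρ).IsNegInvariant := by
  constructor
  have hm : Measurable fun p : Vec d × Vec d => p.1 - p.2 := measurable_fst.sub measurable_snd
  rw [Measure.neg, differenceLaw, Measure.map_map measurable_neg hm]
  nth_rw 1 [← Measure.prod_swap]
  rw [Measure.map_map (measurable_neg.comp hm) measurable_swap]
  congr 1
  funext p
  simp

/-- Tonelli's theorem for the pairs `(w, y)` with `w ∈ S` and `y, w + y ∈ K`, where `w = x - y`. -/
lemma setLIntegral_volume_inter_sub (K S : Set (Vec d)) (hK : MeasurableSet K)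
    (hS : MeasurableSet S) :
    ∫⁻ y in K, volume (K ∩ (fun x => x - y) ⁻¹' S) =
      ∫⁻ w in S, volume (K ∩ (fun y => w + y) ⁻¹' K) := by
  set T : Set (Vec d × Vec d) := {p | p.1 ∈ S ∧ p.2 ∈ K ∧ p.1 + p.2 ∈ K} with hT
  have hTm : MeasurableSet T := (measurable_fst hS).inter
    ((measurable_snd hK).inter ((measurable_fst.add measurable_snd) hK))
  have h1 : (volume.prod volume) T = ∫⁻ w in S, volume (K ∩ (fun y => w + y) ⁻¹' K) := by
    rw [Measure.prod_apply hTm, ← lintegral_indicator hS]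
    refine lintegral_congr fun w => ?_
    by_cases hw : w ∈ S
    · rw [Set.indicator_of_mem hw]
      congr 1; ext y; simp [hT, hw]
    · rw [Set.indicator_of_notMem hw]
      convert measure_empty (μ := (volume : Measure (Vec d)))
      ext y; simp [hT, hw]
  have h2 : (volume.prod volume) T = ∫⁻ y in K, volume (K ∩ (fun x => x - y) ⁻¹' S) := by
    rw [Measure.prod_apply_symm hTm, ← lintegral_indicator hK]
    refine lintegral_congr fun y => ?_
    by_cases hy : y ∈ K
    · rw [Set.indicator_of_mem hy, 
        ← measure_preimage_add_right volume y (K ∩ (fun x => x - y) ⁻¹' S)]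
      congr 1; ext w; simp [hT, hy, and_comm]
    · rw [Set.indicator_of_notMem hy]
      convert measure_empty (μ := (volume : Measure (Vec d)))
      ext w; simp [hT, hy]
  rw [← h1, h2]

lemma IsPDF.exists_isCompact {P : Vec d → ℝ} (hP : IsPDF P) :
    ∃ c > 0, ∃ K : Set (Vec d), IsCompact K ∧ 0 < volume K ∧
      ENNReal.ofReal c • volume.restrict K ≤
        volume.withDensity fun z => ENNReal.ofReal (P z) := by
  obtain ⟨n, hn⟩ : ∃ n : ℕ, 0 < volume {z | 1 / ((n : ℝ) + 1) < P z} := by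
    by_contra! hcon
    have h0 : ∀ᵐ z : Vec d, ENNReal.ofReal (P z) = 0 := by
      have h1 : ∀ᵐ z : Vec d, ∀ n : ℕ, ¬ (1 / ((n : ℝ) + 1) < P z) :=
        ae_all_iff.mpr fun n => by
          rw [ae_iff]; simpa using nonpos_iff_eq_zero.mp (hcon n)
      filter_upwards [h1] with z hz
      rw [ENNReal.ofReal_eq_zero]
      by_contra! hpos
      obtain ⟨n, hn⟩ := exists_nat_one_div_lt hpos
      exact hz n hn
    have h1 := hP.lintegral_eq_one
    rw [lintegral_congr_ae h0, lintegral_zero] at h1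
    exact zero_ne_one h1
  have hm : MeasurableSet {z | 1 / ((n : ℝ) + 1) < P z} :=
    measurableSet_lt measurable_const hP.measurable
  obtain ⟨K, hK, hKc, hK0⟩ := hm.exists_lt_isCompact hn
  refine ⟨1 / ((n : ℝ) + 1), by positivity, K, hKc, hK0, Measure.le_iff.mpr fun S hS => ?_⟩
  rw [Measure.smul_apply, smul_eq_mul, Measure.restrict_apply hS, withDensity_apply _ hS]
  calc _ = ∫⁻ _z in S ∩ K, ENNReal.ofReal (1 / ((n : ℝ) + 1)) := by rw [setLIntegral_const]
    _ ≤ ∫⁻ z in S ∩ K, ENNReal.ofReal (P z) :=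
      setLIntegral_mono hP.measurable.ennreal_ofReal fun z hz =>
        ENNReal.ofReal_le_ofReal (hK hz.2).le
    _ ≤ _ := lintegral_mono_set Set.inter_subset_left

open scoped Pointwise in
/-- The difference of two independent vectors with a common density has a density bounded from
below near the origin. -/
lemma IsPDF.hasDensityNearZero_differenceLaw {P : Vec d → ℝ} (hP : IsPDF P) :
    HasDensityNearZero
      (differenceLaw (volume.withDensity fun z => ENNReal.ofReal (P z))) := by
  obtain ⟨c, hc, K, hK, hK0, hle⟩ := hP.exists_isCompact
  set ρ : Measure (Vec d) := volume.withDensity fun z => ENNReal.ofReal (P z) with hρ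
  have hKtop : volume K ≠ ⊤ := hK.measure_lt_top.ne
  have hK2 : volume K / 2 ≠ 0 := (ENNReal.half_pos hK0.ne').ne'
  -- Steinhaus: small translates of the compact set `K` overlap it in at least half its volume.
  obtain ⟨E, hE, hball⟩ := Metric.eventually_nhds_iff.mp
    (eventually_nhds_zero_measure_vadd_sdiff_lt (μ := volume) hK hK.isClosed hK2)
  have hov : ∀ w ∈ Metric.ball (0 : Vec d) E, volume K / 2 ≤
      volume (K ∩ (fun y => w + y) ⁻¹' K) := by
    intro w hw
    have h1 := hball (y := -w) (by simpa [dist_eq_norm] using hw)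
    have e : (fun y => w + y) ⁻¹' K = -w +ᵥ K := by
      ext y
      rw [Set.mem_vadd_set_iff_neg_vadd_mem, neg_neg, vadd_eq_add, Set.mem_preimage]
    have h2 := measure_inter_add_sdiff (μ := volume) (-w +ᵥ K) hK.measurableSet
    rw [measure_vadd] at h2
    have h3 : volume K / 2 + volume K / 2 ≤ volume ((-w +ᵥ K) ∩ K) + volume K / 2 := by
      rw [ENNReal.add_halves]; exact h2.ge.trans (add_le_add_right h1.le _)
    rw [e, Set.inter_comm]
    exact (ENNReal.add_le_add_iff_right (ENNReal.div_ne_top hKtop (by simp))).mp h3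
  refine ⟨E, hE, c * (c * (volume K / 2).toReal), by
    have := ENNReal.toReal_pos hK2 (ENNReal.div_ne_top hKtop (by simp)); positivity,
    fun S hS hSE => ?_⟩
  have hm : Measurable fun p : Vec d × Vec d => p.1 - p.2 := measurable_fst.sub measurable_snd
  rw [differenceLaw, Measure.map_apply hm hS, Measure.prod_apply_symm (hm hS),
    ENNReal.ofReal_mul hc.le, ENNReal.ofReal_mul hc.le,
    ENNReal.ofReal_toReal (ENNReal.div_ne_top hKtop (by simp))]
  calc ENNReal.ofReal c * (ENNReal.ofReal c * (volume K / 2)) * volume S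
      = ENNReal.ofReal c * (ENNReal.ofReal c * ∫⁻ _w in S, volume K / 2) := by
        rw [setLIntegral_const]; ring
    _ ≤ ENNReal.ofReal c * (ENNReal.ofReal c *
          ∫⁻ w in S, volume (K ∩ (fun y => w + y) ⁻¹' K)) := by
        exact mul_le_mul_right (mul_le_mul_right
          (setLIntegral_mono' hS fun w hw => hov w (hSE hw)) _) _
    _ = ∫⁻ y, ENNReal.ofReal c * volume (K ∩ (fun x => x - y) ⁻¹' S)
          ∂(ENNReal.ofReal c • volume.restrict K) := by
        rw [← setLIntegral_volume_inter_sub K S hK.measurableSet hS, lintegral_smul_measure,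
          lintegral_const_mul' _ _ ENNReal.ofReal_ne_top, smul_eq_mul]
    _ ≤ ∫⁻ y, ρ ((fun x => x - y) ⁻¹' S) ∂ρ := by
        refine lintegral_mono' hle fun y => ?_
        refine le_trans (le_of_eq ?_) (hle _)
        rw [Measure.smul_apply, smul_eq_mul, Measure.restrict_apply
          ((measurable_sub_const y) hS), Set.inter_comm]
    _ = _ := rfl

lemma HasDensityNearZero.uniformlyPositive_const {ν : Measure (Vec d)} [IsFiniteMeasure ν]
    (hν : HasDensityNearZero ν) : UniformlyPositive (Kernel.const (Vec d) ν) := by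
  obtain ⟨E, hE, c, hc, h⟩ := hν
  refine ⟨E, hE, fun r hr => ⟨c * (volume (Metric.ball (0 : Vec d) r)).toReal, mul_pos hc
    (ENNReal.toReal_pos (Metric.measure_ball_pos _ _ hr).ne' measure_ball_lt_top.ne),
    fun y p hp => ?_⟩⟩
  have h1 := ENNReal.toReal_mono (measure_ne_top _ _) (h _ measurableSet_ball hp)
  rwa [ENNReal.toReal_mul, ENNReal.toReal_ofReal hc.le, Measure.addHaar_ball_center] at h1

end Difference

/-! ### Runs -/

section Run

variable {d q : ℕ} {Ω : Type u} {Ξ : Type v} [MeasurableSpace Ω] [MeasurableSpace Ξ]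
  {est : GradEstimator d q} {Ψ : Vec d → Vec d} {f : Vec d → Ξ → ℝ} {α : ℕ → ℝ} {x₁ : Vec d}
  {ξ : ℕ → Fin q → Ω → Ξ} {x : ℕ → Ω → Vec d}

lemma IsRun.measurable (h : IsRun est Ψ f α x₁ ξ x) (hΨ : Measurable Ψ) (hf : IsLoss f)
    (hξ : ∀ t j, Measurable (ξ t j)) (hpoint : ∀ j, Measurable (est.point j))
    (hcombine : Measurable est.combine) {k : ℕ} (hk : 1 ≤ k) : Measurable (x k) := by
  induction k, hk using Nat.le_induction with
  | base =>
    rw [show x 1 = fun _ => x₁ from funext h.init]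
    exact measurable_const
  | succ k hk ih =>
    rw [show x (k + 1) = _ from funext (h.step k hk)]
    have h1 : Measurable fun ω => Ψ (est.combine fun j =>
        oracle f (est.point j (x k ω)) (ξ k j ω)) :=
      hΨ.comp (hcombine.comp (measurable_pi_lambda _ fun j =>
        hf.measurable.comp (((hpoint j).comp ih).prodMk (hξ k j))))
    exact ih.sub (h1.const_smul (α k))

lemma measurable_noise {F : Vec d → ℝ} (hF : Continuous (gradient F)) (hf : IsLoss f)
    (hξ : ∀ t j, Measurable (ξ t j)) (hpoint : ∀ j, Measurable (est.point j)) {t : ℕ}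
    (hx : Measurable (x t)) (j : Fin q) : Measurable (noise est F f ξ x t j) :=
  (hf.measurable.comp (((hpoint j).comp hx).prodMk (hξ t j))).sub
    (hF.measurable.comp ((hpoint j).comp hx))

end Run

/-- If the updates are driven by differences of independent noise vectors, then the difference
is independent of the past. -/
lemma IsIIDNoise.hasStateKernel {d : ℕ} {Ω : Type u} [MeasurableSpace Ω] {μ : Measure Ω}
    [IsProbabilityMeasure μ] {z : ℕ → Fin 2 → Ω → Vec d} {P : Vec d → ℝ} (h : IsIIDNoise μ z P)
    {x : ℕ → Ω → Vec d} {x₁ : Vec d} {step : ℕ → Vec d × Vec d → Vec d}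
    (hstep : ∀ t, Measurable (step t)) (hx1 : ∀ ω, x 1 ω = x₁)
    (hx : ∀ t, 1 ≤ t → ∀ ω, x (t + 1) ω = step t (x t ω, z t 0 ω - z t 1 ω))
    (hz : ∀ t, 1 ≤ t → ∀ j, Measurable (z t j)) :
    HasStateKernel μ x (fun t ω => z t 0 ω - z t 1 ω) (Kernel.const (Vec d)
      (differenceLaw (volume.withDensity fun u => ENNReal.ofReal (P u)))) := by
  intro t ht S B hS hB
  set m : ℕ × Fin 2 → MeasurableSpace Ω :=
    fun p => MeasurableSpace.comap (z (p.1 + 1) p.2) inferInstance with hm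
  have hmle : ∀ p, m p ≤ ‹MeasurableSpace Ω› := fun p => (hz (p.1 + 1) (by omega) p.2).comap_le
  have hzm : ∀ (I : Set (ℕ × Fin 2)) k j, 1 ≤ k → (k - 1, j) ∈ I →
      Measurable[⨆ p ∈ I, m p] (z k j) := by
    intro I k j hk hI
    have h1 : m (k - 1, j) = MeasurableSpace.comap (z k j) inferInstance := by
      simp only [hm, Nat.sub_add_cancel hk]
    exact (comap_measurable (z k j)).mono (h1 ▸ le_iSup₂_of_le (k - 1, j) hI le_rfl) le_rfl
  -- The index `p` stands for time `p.1 + 1`. The past is generated by noise at times before `t`,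
  -- the set `I`, and `z t` by `J`; disjointness gives independence.
  set I : Set (ℕ × Fin 2) := {p | p.1 + 1 < t} with hI
  set J : Set (ℕ × Fin 2) := {p | p.1 + 1 = t} with hJ
  have hxm : ∀ k, 1 ≤ k → k ≤ t → Measurable[⨆ p ∈ I, m p] (x k) := by
    intro k hk
    induction k, hk using Nat.le_induction with
    | base =>
      intro _
      rw [show x 1 = fun _ => x₁ from funext hx1]
      exact measurable_const
    | succ k hk ih =>
      intro hkt
      rw [show x (k + 1) = _ from funext (hx k hk)]
      have hmem : ∀ j, (k - 1, j) ∈ I := fun j => by simp only [hI, Set.mem_ofPred_eq]; omega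
      exact (hstep k).comp ((ih (by omega)).prodMk
        ((hzm I k 0 hk (hmem 0)).sub (hzm I k 1 hk (hmem 1))))
  have hpast : past x t ≤ ⨆ p ∈ I, m p := iSup₂_le fun k hk =>
    (hxm k (Finset.mem_Icc.mp hk).1 (Finset.mem_Icc.mp hk).2).comap_le
  have hind : Indep (⨆ p ∈ I, m p) (⨆ p ∈ J, m p) μ :=
    indep_iSup_of_disjoint hmle h.indep.iIndep
      (Set.disjoint_left.mpr fun p (h1 : p.1 + 1 < t) (h2 : p.1 + 1 = t) => by omega)
  have hmemJ : ∀ j, (t - 1, j) ∈ J := fun j => by simp only [hJ, Set.mem_ofPred_eq]; omega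
  have hd : Measurable[⨆ p ∈ J, m p] fun ω => z t 0 ω - z t 1 ω :=
    (hzm J t 0 ht (hmemJ 0)).sub (hzm J t 1 ht (hmemJ 1))
  have hsub : Measurable fun p : Vec d × Vec d => p.1 - p.2 := measurable_fst.sub measurable_snd
  have hpair : IndepFun (z t 0) (z t 1) μ := by
    have := h.indep.indepFun (i := (t - 1, (0 : Fin 2))) (j := (t - 1, 1)) (by simp)
    simpa only [Nat.sub_add_cancel ht] using this
  have hlaw : μ.map (fun ω => z t 0 ω - z t 1 ω) =
      differenceLaw (volume.withDensity fun u => ENNReal.ofReal (P u)) := by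
    have h1 := (indepFun_iff_map_prod_eq_prod_map_map (hz t ht 0).aemeasurable
      (hz t ht 1).aemeasurable).mp hpair
    rw [h.law t ht, h.law t ht] at h1
    rw [differenceLaw, ← h1, Measure.map_map hsub ((hz t ht 0).prodMk (hz t ht 1))]
    rfl
  rw [(Indep_iff _ _ μ).mp hind S _ (hpast S hS) (hd hB), ← hlaw]
  simp only [Kernel.const_apply, lintegral_const, Measure.restrict_apply_univ]
  have hdm : Measurable fun ω => z t 0 ω - z t 1 ω := (hz t ht 0).sub (hz t ht 1)
  rw [Measure.map_apply hdm hB, mul_comm]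

/-! ### The drift of the admissible nonlinearities -/

lemma Nonlinearity.measurable {d : ℕ} {Ψ : Vec d → Vec d} (h : Nonlinearity Ψ) :
    Measurable Ψ := by
  rcases h with ⟨ψ, h, hψ⟩ | ⟨φ, h, hφ⟩
  · exact h.measurable hψ.isSignLike
  · exact h.measurable hφ

lemma Nonlinearity.exists_bound {d : ℕ} {Ψ : Vec d → Vec d} (h : Nonlinearity Ψ) :
    ∃ C > 0, ∀ x, ‖Ψ x‖ ≤ C := by
  rcases h with ⟨ψ, h, hψ⟩ | ⟨φ, h, hφ⟩
  · exact h.exists_bound hψ.isSignLike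
  · obtain ⟨C, hC, hb⟩ := hφ.bounded
    exact ⟨C, hC, fun x => by rw [h x]; exact hb x⟩

lemma SmoothNonlinearity.exists_drift {d : ℕ} (hd : 0 < d) {Ψ : Vec d → Vec d}
    (h : SmoothNonlinearity Ψ) {κ : Kernel (Vec d) (Vec d)} [IsMarkovKernel κ]
    [∀ y, (κ y).IsNegInvariant] (hκ : UniformlyPositive κ) :
    ∃ β > 0, ∀ y v, β * minNormSq v ≤ ∫ z, inner ℝ (Ψ (v + z)) v ∂κ y := by
  rcases h.general with ⟨ψ, hc, hψ⟩ | ⟨φ, hj, hφ⟩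
  · exact hc.exists_drift_of_contDiff hd hψ.isSignLike
      ((h.smooth ψ hc).1.of_le one_le_two) hκ
  -- For `d = 1` the smoothness condition, stated for every scalar representation of `Ψ`, also
  -- applies to `r ↦ φ |r| * r`.
  · rcases (Nat.succ_le_iff.mpr hd).eq_or_lt with rfl | hd2
    · have hc := hj.isComponentwise
      exact hc.exists_drift_of_contDiff hd hφ.isSignLike
        ((h.smooth _ hc).1.of_le one_le_two) hκ
    · exact hj.exists_drift hd2 hφ hκ

/-- Here `ψ` may jump, so component-wise maps use the density lower bound; joint maps with `d ≥ 2`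
only need the probabilities of balls. -/
lemma Nonlinearity.exists_drift {d : ℕ} (hd : 0 < d) {Ψ : Vec d → Vec d} (h : Nonlinearity Ψ)
    {ν : Measure (Vec d)} [IsProbabilityMeasure ν] [ν.IsNegInvariant]
    (hν : HasDensityNearZero ν) :
    ∃ β > 0, ∀ y v, β * minNormSq v ≤
      ∫ z, inner ℝ (Ψ (v + z)) v ∂(Kernel.const (Vec d) ν y) := by
  rcases h with ⟨ψ, hc, hψ⟩ | ⟨φ, hj, hφ⟩
  · obtain ⟨β, hβ, hb⟩ := hc.exists_drift_of_density hd hψ.isSignLike hν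
    exact ⟨β, hβ, fun _ => hb⟩
  · rcases (Nat.succ_le_iff.mpr hd).eq_or_lt with rfl | hd2
    · obtain ⟨β, hβ, hb⟩ := hj.isComponentwise.exists_drift_of_density hd hφ.isSignLike hν
      exact ⟨β, hβ, fun _ => hb⟩
    · have : ∀ y, (Kernel.const (Vec d) ν y).IsNegInvariant := fun y => by
        rw [Kernel.const_apply]; infer_instance
      exact hj.exists_drift hd2 hφ hν.uniformlyPositive_const

/-! ### The two methods -/

theorem corollary2 (d : ℕ) (hd : 0 < d) :
    -- symmetric state-dependent noise
    (∀ (Ψ : Vec d → Vec d) (P : Vec d → Vec d → ℝ),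
      SmoothNonlinearity Ψ → IsSymmetricNoise P →
      ∀ L Δ a : ℝ, 0 < a → ∃ M > 0, ∃ K > 0,
        ∀ (F : Vec d → ℝ) (x₁ : Vec d), IsSmoothCost F L → F x₁ - ⨅ y, F y ≤ Δ →
        ∀ (Ω : Type u) (Ξ : Type v) [MeasurableSpace Ω] [MeasurableSpace Ξ]
          (μ : Measure Ω) [IsProbabilityMeasure μ]
          (f : Vec d → Ξ → ℝ) (ξ : ℕ → Fin 1 → Ω → Ξ) (x : ℕ → Ω → Vec d),
          IsLoss f → (∀ t j, Measurable (ξ t j)) →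
          IsRun (sgd d) Ψ f (stepSize a (1 / 2)) x₁ ξ x →
          HasStateDensity μ x (fun t => noise (sgd d) F f ξ x t 0) P →
          HasRate μ F x M ∧ HasComplexity 1 μ F x K) ∧
    -- possibly non-symmetric independent noise
    (∀ (Ψ : Vec d → Vec d) (P : Vec d → ℝ),
      Nonlinearity Ψ → IsOverlapNoise P →
      ∀ L Δ a : ℝ, 0 < a → ∃ M > 0, ∃ K > 0,
        ∀ (F : Vec d → ℝ) (x₁ y : Vec d), IsSmoothCost F L → F x₁ - ⨅ y, F y ≤ Δ →
        ∀ (Ω : Type u) (Ξ : Type v) [MeasurableSpace Ω] [MeasurableSpace Ξ]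
          (μ : Measure Ω) [IsProbabilityMeasure μ]
          (f : Vec d → Ξ → ℝ) (ξ : ℕ → Fin 2 → Ω → Ξ) (x : ℕ → Ω → Vec d),
          IsLoss f → (∀ t j, Measurable (ξ t j)) →
          IsRun (sge F y) Ψ f (stepSize a (1 / 2)) x₁ ξ x →
          IsIIDNoise μ (noise (sge F y) F f ξ x) P →
          HasRate μ F x M ∧ HasComplexity 2 μ F x K) := by

  refine ⟨fun Ψ P hΨ hP L Δ a ha => ?_, fun Ψ P hΨ hP L Δ a ha => ?_⟩
  · have := hP.isMarkovKernel
    have := hP.isNegInvariant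
    obtain ⟨C, hC0, hC⟩ := hΨ.general.exists_bound
    obtain ⟨β, hβ, hdrift⟩ := hΨ.exists_drift hd hP.uniformlyPositive
    obtain ⟨M, hM, hrate⟩ :=
      exists_hasRate_of_drift.{u} hΨ.general.measurable hC hC0 hβ hdrift L Δ a ha
    refine ⟨M, hM, (1 : ℕ) * (13 * M + 1) ^ 4, by positivity, ?_⟩
    intro F x₁ hF hFΔ Ω Ξ _ _ μ _ f ξ x hf hξ hrun hdens
    have hpoint : ∀ j, Measurable ((sgd d).point j) := fun _ => measurable_id
    have hx : ∀ k, 1 ≤ k → Measurable (x k) := fun k hk =>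
      hrun.measurable hΨ.general.measurable hf hξ hpoint (measurable_pi_apply 0) hk
    have hz : ∀ k, 1 ≤ k → Measurable (noise (sgd d) F f ξ x k 0) := fun k hk =>
      measurable_noise hF.continuous_gradient hf hξ hpoint (hx k hk) 0
    have hR : HasRate μ F x M := hrate F x₁ hF hFΔ Ω μ x
      (fun t => noise (sgd d) F f ξ x t 0) hrun.init
      (fun t ht ω => by rw [hrun.step t ht ω]; simp [noise, sgd]) hx hz
      (hP.hasStateKernel hx hz hdens)
    exact ⟨hR, hR.hasComplexity le_rfl hM⟩
  · set ρ : Measure (Vec d) := volume.withDensity fun z => ENNReal.ofReal (P z) with hρ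
    have : IsProbabilityMeasure ρ := ⟨by
      rw [hρ, withDensity_apply _ MeasurableSet.univ, Measure.restrict_univ]
      exact hP.pdf.lintegral_eq_one⟩
    obtain ⟨C, hC0, hC⟩ := hΨ.exists_bound
    obtain ⟨β, hβ, hdrift⟩ := hΨ.exists_drift hd hP.pdf.hasDensityNearZero_differenceLaw
    obtain ⟨M, hM, hrate⟩ := exists_hasRate_of_drift.{u} hΨ.measurable hC hC0 hβ hdrift L Δ a ha
    refine ⟨M, hM, (2 : ℕ) * (13 * M + 1) ^ 4, by positivity, ?_⟩
    intro F x₁ y hF hFΔ Ω Ξ _ _ μ _ f ξ x hf hξ hrun hiid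
    have hpoint : ∀ j, Measurable ((sge F y).point j) := by
      intro j
      fin_cases j
      · exact measurable_id
      · exact measurable_const
    have hx : ∀ k, 1 ≤ k → Measurable (x k) := fun k hk =>
      hrun.measurable hΨ.measurable hf hξ hpoint
        (((measurable_pi_apply 0).sub (measurable_pi_apply 1)).add_const _) hk
    have hz : ∀ k, 1 ≤ k → ∀ j, Measurable (noise (sge F y) F f ξ x k j) := fun k hk j =>
      measurable_noise hF.continuous_gradient hf hξ hpoint (hx k hk) j
    -- The known `∇F(y)` cancels the mean of the second answer, so the estimator is `∇F(x^t)` plus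
    -- the difference of the two noise vectors.
    have hstep : ∀ t, 1 ≤ t → ∀ ω, x (t + 1) ω = x t ω - stepSize a (1 / 2) t •
        Ψ (gradient F (x t ω) +
          (noise (sge F y) F f ξ x t 0 ω - noise (sge F y) F f ξ x t 1 ω)) := by
      intro t ht ω
      rw [hrun.step t ht ω]
      congr 3
      simp only [noise, sge, Matrix.cons_val_zero, Matrix.cons_val_one]
      abel
    have hg : Measurable fun p : Vec d × Vec d => Ψ (gradient F p.1 + p.2) :=
      hΨ.measurable.comp ((hF.continuous_gradient.measurable.comp measurable_fst).add
        measurable_snd)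
    have hR : HasRate μ F x M := hrate F x₁ hF hFΔ Ω μ x
      (fun t ω => noise (sge F y) F f ξ x t 0 ω - noise (sge F y) F f ξ x t 1 ω) hrun.init
      hstep hx (fun k hk => (hz k hk 0).sub (hz k hk 1))
      (hiid.hasStateKernel
        (step := fun t p => p.1 - stepSize a (1 / 2) t • Ψ (gradient F p.1 + p.2))
        (fun t => measurable_fst.sub (hg.const_smul (stepSize a (1 / 2) t)))
        hrun.init hstep hz)
    exact ⟨hR, hR.hasComplexity one_le_two hM⟩
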